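/- Let $X$ be a complex Banach space and let $S$ be a linear operator in $X$ with (not necessarily dense) domain $\mathcal D(S)\subset X$. Let $\varrho(S)$ be the set of $\lambda\in\mathbb C$ for which $S-\lambda:\mathcal D(S)\to X$ is bijective with bounded inverse, and $\sigma(S)=\mathbb C\setminus\varrho(S)$. Assume that for some $h>0$ $$\{\lambda\in\mathbb C : |\operatorname{Re}\lambda|\le h\}\subset\varrho(S),\qquad M:=\sup_{|\operatorname{Re}\lambda|\le h}\|(S-\lambda)^{-1}\|<\infty .$$ Let $\mathbb C_+$ and $\mathbb C_-$ be the open right and left half-planes. Let $G_\pm$ be the set of all $x\in X$ for which $\lambda\mapsto(S-\lambda)^{-1}x$, $\lambda\in\varrho(S)$, has an analytic extension to (an open neighbourhood of) $\overline{\mathbb C_\mp}\cup\varrho(S)$ that is bounded on $\overline{\mathbb C_\mp}$; these are linear subspaces. A subspace $G$ is called $S$-invariant if $S(\mathcal D(S)\cap G)\subset G$, and then $S|G$ denotes the operator in $G$ with domain $\mathcal D(S)\cap G$ given by $S$. Define $$A_\pm=\frac{\pm1}{2\pi i}\int_{\pm h-i\infty}^{\pm h+i\infty}\frac1{\lambda^2}(S-\lambda)^{-1}\,d\lambda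 ,$$ and let $P_\pm=S^2A_\pm$, with domain $\mathcal D(P_\pm)=\{x\in X: A_\pm x\in\mathcal D(S^2)\}$. A possibly unbounded operator $P$ in $X$ is called a projection if its range is contained in $\mathcal D(P)$ and $P^2=P$; the complementary projection is $I-P$ with domain $\mathcal D(P)$. Then: (i) The subspaces $G_\pm$ are closed, $S$-invariant, and $(S-\lambda)^{-1}$-invariant for every $\lambda\in\varrho(S)$, and $$\sigma(S)=\sigma(S|G_+)\cup\sigma(S|G_-),\qquad \sigma(S|G_\pm)=\sigma(S)\cap\mathbb C_\pm,$$ $$\overline{\mathbb C_\mp}\subset\varrho(S|G_\pm),\qquad \|(S|G_\pm-\lambda)^{-1}\|\le M\quad\text{for }\lambda\in\overline{\mathbb C_\mp}.$$ (ii) The integrals defining $A_\pm$ converge absolutely in the operator norm, and $P_+$ and $P_-$ are closed complementary projections. Moreover $G_+\cap G_-=\{0\}$, $\mathcal D(P_+)=\mathcal D(P_-)=G_+\oplus G_-$, and $G_\pm=\operatorname{ran}P_\pm=\ker A_\mp$; thus $P_+(x+y)=x$ and $P_-(x+y)=y$ for $x\in G_+$, $y\in G_-$. (iii) $\mathcal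 D(S^2)\subset\mathcal D(P_\pm)$, and for every $x\in\mathcal D(S^2)$ $$P_\pm x=\frac{\pm1}{2\pi i}\int_{\pm h-i\infty}^{\pm h+i\infty}\frac1{\lambda^2}(S-\lambda)^{-1}S^2x\,d\lambda ,$$ where the integrals converge absolutely. -/

import Mathlib

noncomputable section

open Complex MeasureTheory

namespace SpectralSplitting

/-! ### Unbounded operators: products, resolvent, parts in subspaces -/

section Operators

variable {E F G : Type*} [AddCommGroup E] [Module ℂ E] [AddCommGroup F] [Module ℂ F]
  [AddCommGroup G] [Module ℂ G]

/-- The product `g f` of two operators on its maximal domain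
`{x ∈ D(f) | f x ∈ D(g)}`. -/
def prodOp (g : F →ₗ.[ℂ] G) (f : E →ₗ.[ℂ] F) : E →ₗ.[ℂ] G where
  domain :=
    { carrier := {x | ∃ hx : x ∈ f.domain, f ⟨x, hx⟩ ∈ g.domain}
      zero_mem' := ⟨f.domain.zero_mem, by
        have h : f ⟨0, f.domain.zero_mem⟩ = 0 := f.map_zero
        rw [h]; exact g.domain.zero_mem⟩
      add_mem' := by
        rintro x y ⟨hx, hfx⟩ ⟨hy, hfy⟩
        refine ⟨f.domain.add_mem hx hy, ?_⟩
        have h : f ⟨x + y, f.domain.add_mem hx hy⟩ = f ⟨x, hx⟩ + f ⟨y, hy⟩ :=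
          f.map_add ⟨x, hx⟩ ⟨y, hy⟩
        rw [h]; exact g.domain.add_mem hfx hfy
      smul_mem' := by
        rintro c x ⟨hx, hfx⟩
        refine ⟨f.domain.smul_mem c hx, ?_⟩
        have h : f ⟨c • x, f.domain.smul_mem c hx⟩ = c • f ⟨x, hx⟩ :=
          f.map_smul c ⟨x, hx⟩
        rw [h]; exact g.domain.smul_mem c hfx }
  toFun :=
    { toFun := fun x => g ⟨f ⟨x, x.2.choose⟩, x.2.choose_spec⟩
      map_add' := by
        intro x y
        rw [← g.map_add]
        congr 1
        exact Subtype.ext (f.map_add ⟨x, x.2.choose⟩ ⟨y, y.2.choose⟩)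
      map_smul' := by
        intro c x
        rw [RingHom.id_apply, ← g.map_smul]
        congr 1
        exact Subtype.ext (f.map_smul c ⟨x, x.2.choose⟩) }

/-- The subspace `G` is `S`-invariant: `S (D(S) ∩ G) ⊆ G`. -/
def IsInvariantUnder (S : E →ₗ.[ℂ] E) (G : Submodule ℂ E) : Prop :=
  ∀ x : S.domain, (x : E) ∈ G → S x ∈ G

/-- The operator that `S` induces in the subspace `G`, with domain
`{x ∈ G | x ∈ D(S), S x ∈ G}`. For an `S`-invariant `G` this domain is `D(S) ∩ G`, and the
operator is the restriction `S|G` of `S`. -/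
def restrictTo (S : E →ₗ.[ℂ] E) (G : Submodule ℂ E) : G →ₗ.[ℂ] G where
  domain :=
    { carrier := {x | ∃ hx : (x : E) ∈ S.domain, S ⟨x, hx⟩ ∈ G}
      zero_mem' := ⟨S.domain.zero_mem, by
        have h : S ⟨((0 : G) : E), S.domain.zero_mem⟩ = 0 := S.map_zero
        rw [h]; exact G.zero_mem⟩
      add_mem' := by
        rintro x y ⟨hx, hSx⟩ ⟨hy, hSy⟩
        refine ⟨S.domain.add_mem hx hy, ?_⟩
        have h : S ⟨((x + y : G) : E), S.domain.add_mem hx hy⟩ = S ⟨x, hx⟩ + S ⟨y, hy⟩ :=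
          S.map_add ⟨x, hx⟩ ⟨y, hy⟩
        rw [h]; exact G.add_mem hSx hSy
      smul_mem' := by
        rintro c x ⟨hx, hSx⟩
        refine ⟨S.domain.smul_mem c hx, ?_⟩
        have h : S ⟨((c • x : G) : E), S.domain.smul_mem c hx⟩ = c • S ⟨x, hx⟩ :=
          S.map_smul c ⟨x, hx⟩
        rw [h]; exact G.smul_mem c hSx }
  toFun :=
    { toFun := fun x => ⟨S ⟨((x : G) : E), x.2.choose⟩, x.2.choose_spec⟩
      map_add' := by
        intro x y
        exact Subtype.ext (S.map_add ⟨((x : G) : E), x.2.choose⟩ ⟨((y : G) : E), y.2.choose⟩)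
      map_smul' := by
        intro c x
        exact Subtype.ext (S.map_smul c ⟨((x : G) : E), x.2.choose⟩) }

/-- The identity operator with domain the whole space. -/
def idOp (E : Type*) [AddCommGroup E] [Module ℂ E] : E →ₗ.[ℂ] E :=
  (LinearMap.id : E →ₗ[ℂ] E).toPMap ⊤

/-- A possibly unbounded projection: `ran P ⊆ D(P)` and `P² = P`. -/
def IsProjection (P : E →ₗ.[ℂ] E) : Prop :=
  (∀ x : P.domain, P x ∈ P.domain) ∧ prodOp P P = P

/-- `P` and `Q` are complementary projections: `P` and `Q` are projections and
`Q = I - P` with `D(Q) = D(P)`. -/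
def AreComplementaryProjections (P Q : E →ₗ.[ℂ] E) : Prop :=
  IsProjection P ∧ IsProjection Q ∧ Q = idOp E - P

end Operators

section Resolvent

variable {X : Type*} [NormedAddCommGroup X] [NormedSpace ℂ X]

/-- The bounded operator `R` is the two-sided inverse of `S - z : D(S) → X`. -/
def IsResolventAt (S : X →ₗ.[ℂ] X) (z : ℂ) (R : X →L[ℂ] X) : Prop :=
  (∀ x : X, ∃ hx : R x ∈ S.domain, S ⟨R x, hx⟩ - z • R x = x) ∧
    ∀ x : S.domain, R (S x - z • (x : X)) = x

/-- The resolvent set `ϱ(S)`. -/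
def resolventSet (S : X →ₗ.[ℂ] X) : Set ℂ := {z | ∃ R : X →L[ℂ] X, IsResolventAt S z R}

/-- The spectrum `σ(S) = ℂ ∖ ϱ(S)`. -/
def spectrumOf (S : X →ₗ.[ℂ] X) : Set ℂ := (resolventSet S)ᶜ

open Classical in
/-- The resolvent `(S - z)⁻¹` for `z ∈ ϱ(S)` (and `0` for `z ∉ ϱ(S)`). -/
def resolventOp (S : X →ₗ.[ℂ] X) (z : ℂ) : X →L[ℂ] X :=
  if h : ∃ R : X →L[ℂ] X, IsResolventAt S z R then h.choose else 0

/-- The vectors `x` for which `z ↦ (S - z)⁻¹ x`, `z ∈ ϱ(S)`, has an analytic extension to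
`H ∪ ϱ(S)` that is bounded on `H`. (Analytic on a set means: analytic on an open
neighbourhood of it.) -/
def boundedExtensionSpace (S : X →ₗ.[ℂ] X) (H : Set ℂ) : Submodule ℂ X where
  carrier := {x | ∃ φ : ℂ → X, AnalyticOnNhd ℂ φ (H ∪ resolventSet S) ∧
    (∀ z ∈ resolventSet S, φ z = resolventOp S z x) ∧ ∃ C : ℝ, ∀ z ∈ H, ‖φ z‖ ≤ C}
  zero_mem' := ⟨fun _ => 0, analyticOnNhd_const, by simp, 0, by simp⟩
  add_mem' := by
    rintro x y ⟨φ, hφ, hφe, C, hC⟩ ⟨ψ, hψ, hψe, D, hD⟩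
    refine ⟨fun z => φ z + ψ z, hφ.add hψ, fun z hz => ?_, C + D, fun z hz => ?_⟩
    · simp only [hφe z hz, hψe z hz, map_add]
    · exact (norm_add_le _ _).trans (add_le_add (hC z hz) (hD z hz))
  smul_mem' := by
    rintro c x ⟨φ, hφ, hφe, C, hC⟩
    refine ⟨fun z => c • φ z, fun z hz => analyticAt_const.smul (hφ z hz),
      fun z hz => ?_, ‖c‖ * C, fun z hz => ?_⟩
    · simp only [hφe z hz, map_smul]
    · rw [norm_smul]
      exact mul_le_mul_of_nonneg_left (hC z hz) (norm_nonneg c)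

/-- `G₊`: the extension is to the closed left half-plane. -/
def Gplus (S : X →ₗ.[ℂ] X) : Submodule ℂ X := boundedExtensionSpace S {z | z.re ≤ 0}

/-- `G₋`: the extension is to the closed right half-plane. -/
def Gminus (S : X →ₗ.[ℂ] X) : Submodule ℂ X := boundedExtensionSpace S {z | 0 ≤ z.re}

/-- The integral of `f` along the vertical line `Re z = a`, oriented upwards. -/
def lineIntegral {E : Type*} [NormedAddCommGroup E] [NormedSpace ℂ E] (f : ℂ → E) (a : ℝ) : E :=
  ∫ t : ℝ, I • f (a + t * I)

/-- The integrand `z⁻² (S - z)⁻¹`. -/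
def kernelA (S : X →ₗ.[ℂ] X) (z : ℂ) : X →L[ℂ] X := (1 / z ^ 2) • resolventOp S z

/-- `A₊ = 1/(2πi) ∫_{h-i∞}^{h+i∞} z⁻² (S - z)⁻¹ dz`. -/
def Aplus (S : X →ₗ.[ℂ] X) (h : ℝ) : X →L[ℂ] X :=
  (1 / (2 * (Real.pi : ℂ) * I)) • lineIntegral (kernelA S) h

/-- `A₋ = -1/(2πi) ∫_{-h-i∞}^{-h+i∞} z⁻² (S - z)⁻¹ dz`. -/
def Aminus (S : X →ₗ.[ℂ] X) (h : ℝ) : X →L[ℂ] X :=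
  (-1 / (2 * (Real.pi : ℂ) * I)) • lineIntegral (kernelA S) (-h)

/-- The operator `S²` with its maximal domain. -/
def sqOp (S : X →ₗ.[ℂ] X) : X →ₗ.[ℂ] X := prodOp S S

/-- `P₊ = S² A₊` with its maximal domain `{x | A₊ x ∈ D(S²)}`. -/
def Pplus (S : X →ₗ.[ℂ] X) (h : ℝ) : X →ₗ.[ℂ] X :=
  prodOp (sqOp S) ((Aplus S h : X →ₗ[ℂ] X).toPMap ⊤)

/-- `P₋ = S² A₋` with its maximal domain `{x | A₋ x ∈ D(S²)}`. -/
def Pminus (S : X →ₗ.[ℂ] X) (h : ℝ) : X →ₗ.[ℂ] X :=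
  prodOp (sqOp S) ((Aminus S h : X →ₗ[ℂ] X).toPMap ⊤)

end Resolvent

end SpectralSplitting

end

noncomputable section

open Complex MeasureTheory Filter Topology Set

namespace SpectralSplitting

/-! ### Scalar integrals, contour shifts along vertical lines, Phragmén–Lindelöf -/

section Contour

variable {E : Type*} [NormedAddCommGroup E] [NormedSpace ℂ E]

/-! Write `R(z) = (S - z)⁻¹`. Since `0 ∈ ϱ(S)`, the operator `S` is the inverse of the injective
bounded `R(0)`, so statements about `S` become identities between bounded operators. Three facts
carry the theorem.

Cauchy's formula at the double pole `0` of `z⁻² R(z)` gives `A₊ + A₋ = R(0)²` (`Aplus_add_Aminus`).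

Moreover `G₊ = ker A₋` (`mem_Gplus_iff`). For `x ∈ G₊` the contour of `A₋ x` can be pushed to `Re z
= -∞`. Conversely, `R(z) A₊` is a Cauchy integral holomorphic in `Re z < h`; on `ker A₋` one has `A₊
x = R(0)² x`, so expanding `R(z) x` to second order at `0` exhibits an extension of it. That
extension grows at most quadratically and is bounded by `M ‖x‖` on the imaginary axis, so
Phragmén–Lindelöf bounds it by `M ‖x‖` on the left half-plane. By the identity theorem it is the
resolvent of `S|G₊`.

Finally, if `z` lies in the resolvent sets of both parts, with resolvents `T₊` and `T₋`, then `T₊ A₊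
+ T₋ A₋` plays the role of `R(z) R(0)²`, from which `R(z)` is rebuilt
(`mem_resolventSet_of_restrictTo`).

Closedness, invariance and the form of `P₊` follow because `A₊` and `A₋` commute with `R(0)`.
Statements about `G₋`, `A₋`, `P₋` come from those about `G₊`, `A₊`, `P₊` by replacing `S` with `-S`.
-/

theorem sq_add_sq_inv_eq {a : ℝ} (ha : a ≠ 0) (t : ℝ) :
    (a ^ 2 + t ^ 2)⁻¹ = (a ^ 2)⁻¹ * (1 + (t / a) ^ 2)⁻¹ := by
  rw [← mul_inv]
  congr 1
  field_simp

theorem integrable_inv_sq_add_sq {a : ℝ} (ha : a ≠ 0) :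
    Integrable fun t : ℝ => (a ^ 2 + t ^ 2)⁻¹ := by
  simp only [sq_add_sq_inv_eq ha]
  exact (integrable_inv_one_add_sq.comp_div ha).const_mul _

theorem integral_inv_sq_add_sq {a : ℝ} (ha : 0 < a) :
    ∫ t : ℝ, (a ^ 2 + t ^ 2)⁻¹ = Real.pi / a := by
  simp only [sq_add_sq_inv_eq ha.ne']
  rw [integral_const_mul, Measure.integral_comp_div (fun x : ℝ => (1 + x ^ 2)⁻¹) a,
    integral_univ_inv_one_add_sq, abs_of_pos ha, smul_eq_mul]
  field_simp

theorem norm_sq_add_mul_I (a t : ℝ) : ‖(a : ℂ) + t * I‖ ^ 2 = a ^ 2 + t ^ 2 := by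
  rw [← normSq_eq_norm_sq, normSq_add_mul_I]

/-- If `F` decays on the strip `a ≤ Re z ≤ b`, the integrals along the two sides agree. -/
theorem integral_strip_sub_eq_zero {F : ℂ → E} {a b C : ℝ} (hab : a ≤ b)
    (hF : ∀ z : ℂ, a ≤ z.re → z.re ≤ b → DifferentiableAt ℂ F z)
    (hC : ∀ z : ℂ, a ≤ z.re → z.re ≤ b → |z.im| * ‖F z‖ ≤ C)
    (hint : Integrable fun t : ℝ => F (b + t * I) - F (a + t * I)) :
    ∫ t : ℝ, (F (b + t * I) - F (a + t * I)) = 0 := by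
  -- In an incomplete space the Bochner integral is `0` by definition.
  by_cases hE : CompleteSpace E
  swap
  · simp [integral, hE]
  have hlim := intervalIntegral_tendsto_integral hint
    tendsto_neg_atTop_atBot (tendsto_id (x := atTop))
  have hcont : ∀ c : ℝ, a ≤ c → c ≤ b → Continuous fun t : ℝ => F (c + t * I) := by
    intro c hc hc'
    refine continuous_iff_continuousAt.2 fun t => ?_
    refine ContinuousAt.comp (g := F) (hF _ (by simpa) (by simpa)).continuousAt ?_
    fun_prop
  refine tendsto_nhds_unique hlim ?_
  have hbound : ∀ᶠ T : ℝ in atTop,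
      ‖∫ t : ℝ in -T..id T, (F (b + t * I) - F (a + t * I))‖ ≤ 2 * (C * (b - a)) / T := by
    filter_upwards [eventually_gt_atTop 0] with T hT
    have hrect := integral_boundary_rect_eq_zero_of_differentiableOn F (a + (-T : ℝ) * I)
      (b + (T : ℝ) * I) (by
        intro z hz
        rw [mem_reProdIm] at hz
        simp only [add_re, ofReal_re, mul_re, I_re, mul_zero, ofReal_im, I_im, mul_one, sub_self,
          add_zero, uIcc_of_le hab] at hz
        exact (hF z hz.1.1 hz.1.2).differentiableWithinAt)
    simp only [add_re, ofReal_re, mul_re, I_re, mul_zero, ofReal_im, I_im, mul_one, sub_self,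
      add_zero, add_im, mul_im, zero_add] at hrect
    -- The horizontal sides of the rectangle contribute `O(1/T)`.
    have hhor : ∀ s : ℝ, |s| = T → ‖∫ x : ℝ in a..b, F (x + s * I)‖ ≤ C / T * |b - a| := by
      intro s hs
      refine intervalIntegral.norm_integral_le_of_norm_le_const fun x hx => ?_
      rw [uIoc_of_le hab] at hx
      have := hC (x + s * I) (by simpa using hx.1.le) (by simpa using hx.2)
      simp only [add_im, ofReal_im, mul_im, ofReal_re, I_im, mul_one, I_re, mul_zero, add_zero,
        zero_add, hs] at this
      rw [le_div_iff₀ hT]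
      linarith
    rw [id, intervalIntegral.integral_sub ((hcont b hab le_rfl).intervalIntegrable _ _)
      ((hcont a le_rfl hab).intervalIntegrable _ _)]
    have h1 := hhor (-T) (by rw [abs_neg, abs_of_pos hT])
    have h2 := hhor T (abs_of_pos hT)
    rw [abs_of_nonneg (sub_nonneg.2 hab)] at h1 h2
    have h3 : I • ((∫ t : ℝ in -T..T, F (b + t * I)) - ∫ t : ℝ in -T..T, F (a + t * I)) =
        (∫ x : ℝ in a..b, F (x + (T : ℝ) * I)) - ∫ x : ℝ in a..b, F (x + (-T : ℝ) * I) := by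
      rw [smul_sub, ← sub_eq_zero, ← hrect]
      abel
    have h4 := congrArg norm h3
    rw [norm_smul, norm_I, one_mul] at h4
    rw [h4]
    refine (norm_sub_le _ _).trans ((add_le_add h2 h1).trans (le_of_eq ?_))
    ring
  refine squeeze_zero_norm' hbound ?_
  exact tendsto_const_nhds.div_atTop tendsto_id

theorem integrable_vertical {E : Type*} [NormedAddCommGroup E] {F : ℂ → E} {a C : ℝ} (ha : a ≠ 0)
    (hF : Continuous fun t : ℝ => F (a + t * I))
    (hC : ∀ t : ℝ, ‖F (a + t * I)‖ ≤ C * (a ^ 2 + t ^ 2)⁻¹) :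
    Integrable fun t : ℝ => F (a + t * I) :=
  ((integrable_inv_sq_add_sq ha).const_mul C).mono' hF.aestronglyMeasurable
    (Eventually.of_forall hC)

/-- A function that is holomorphic and `O(|z|⁻²)` on the half-plane `Re z ≥ a > 0` has a
vanishing integral along the line `Re z = a`. -/
theorem integral_vertical_eq_zero {F : ℂ → E} {a C : ℝ} (ha : 0 < a)
    (hF : ∀ z : ℂ, a ≤ z.re → DifferentiableAt ℂ F z)
    (hC : ∀ z : ℂ, a ≤ z.re → ‖F z‖ ≤ C * (‖z‖ ^ 2)⁻¹) :
    ∫ t : ℝ, F (a + t * I) = 0 := by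
  have hC0 : 0 ≤ C := by
    have h1 := (norm_nonneg _).trans (hC a (by simp))
    have h2 : 0 < (‖(a : ℂ)‖ ^ 2)⁻¹ := by
      have : ‖(a : ℂ)‖ ≠ 0 := by simpa using ha.ne'
      positivity
    exact nonneg_of_mul_nonneg_left h1 h2
  have hcont : ∀ c : ℝ, a ≤ c → Continuous fun t : ℝ => F (c + t * I) := by
    intro c hc
    refine continuous_iff_continuousAt.2 fun t => ?_
    refine ContinuousAt.comp (g := F) (hF _ (by simpa)).continuousAt ?_
    fun_prop
  have hle : ∀ c : ℝ, a ≤ c → ∀ t : ℝ, ‖F (c + t * I)‖ ≤ C * (c ^ 2 + t ^ 2)⁻¹ := by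
    intro c hc t
    have := hC (c + t * I) (by simpa)
    rwa [norm_sq_add_mul_I] at this
  have hint : ∀ c : ℝ, a ≤ c → Integrable fun t : ℝ => F (c + t * I) := fun c hc =>
    integrable_vertical (ha.trans_le hc).ne' (hcont c hc) (hle c hc)
  have hconst : ∀ c : ℝ, a ≤ c → ∫ t : ℝ, F (c + t * I) = ∫ t : ℝ, F (a + t * I) := by
    intro c hc
    rw [← sub_eq_zero, ← integral_sub (hint c hc) (hint a le_rfl)]
    refine integral_strip_sub_eq_zero (C := C * a⁻¹) hc (fun z hz _ => hF z hz) (fun z hz _ => ?_)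
      ((hint c hc).sub (hint a le_rfl))
    have hz0 : a ≤ ‖z‖ := hz.trans ((le_abs_self _).trans (abs_re_le_norm z))
    have hzp : 0 < ‖z‖ := ha.trans_le hz0
    calc |z.im| * ‖F z‖ ≤ ‖z‖ * (C * (‖z‖ ^ 2)⁻¹) :=
          mul_le_mul (abs_im_le_norm z) (hC z hz) (norm_nonneg _) hzp.le
      _ = C * ‖z‖⁻¹ := by field_simp
      _ ≤ C * a⁻¹ := by gcongr
  have hdom : ∀ c : ℝ, a ≤ c → ∀ t : ℝ, ‖F (c + t * I)‖ ≤ C * (a ^ 2 + t ^ 2)⁻¹ := by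
    intro c hc t
    refine (hle c hc t).trans ?_
    gcongr
  -- The integral over `Re z = c` does not depend on `c`, yet tends to `0` as `c → ∞`.
  have hlim : Tendsto (fun c : ℝ => ∫ t : ℝ, F (c + t * I)) atTop (𝓝 (∫ _ : ℝ, (0 : E))) := by
    refine tendsto_integral_filter_of_dominated_convergence
      (fun t : ℝ => C * (a ^ 2 + t ^ 2)⁻¹) ?_ ?_ ((integrable_inv_sq_add_sq ha.ne').const_mul C) ?_
    · filter_upwards [eventually_ge_atTop a] with c hc using (hcont c hc).aestronglyMeasurable
    · filter_upwards [eventually_ge_atTop a] with c hc using Eventually.of_forall (hdom c hc)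
    · refine Eventually.of_forall fun t => ?_
      refine squeeze_zero_norm' (a := fun c : ℝ => C * (c ^ 2 + t ^ 2)⁻¹) ?_ ?_
      · filter_upwards [eventually_ge_atTop a] with c hc using hle c hc t
      · rw [← mul_zero C]
        refine Tendsto.const_mul C (tendsto_inv_atTop_zero.comp ?_)
        exact tendsto_atTop_add_const_right _ _ (tendsto_pow_atTop two_ne_zero)
  rw [integral_zero] at hlim
  refine tendsto_nhds_unique (Tendsto.congr' ?_ tendsto_const_nhds) hlim
  filter_upwards [eventually_ge_atTop a] with c hc using (hconst c hc).symm

/-- The Phragmén–Lindelöf principle in the right half-plane for functions of at most quadratic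
growth. -/
theorem norm_le_of_quadratic_growth {f : ℂ → E} {C K : ℝ}
    (hd : DiffContOnCl ℂ f {z | 0 < z.re})
    (hK : ∀ z : ℂ, 0 ≤ z.re → ‖f z‖ ≤ K * (1 + ‖z‖) ^ 2)
    (him : ∀ t : ℝ, ‖f (t * I)‖ ≤ C) {z : ℂ} (hz : 0 ≤ z.re) : ‖f z‖ ≤ C := by
  have hK0 : 0 ≤ K := by simpa using (norm_nonneg _).trans (hK 0 (by simp))
  have hge : ∀ ε : ℝ, 0 ≤ ε → ∀ w : ℂ, 0 ≤ w.re → 1 ≤ ‖1 + ε * w‖ := by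
    intro ε hε w hw
    refine le_trans ?_ ((le_abs_self _).trans (abs_re_le_norm _))
    simp only [add_re, one_re, mul_re, ofReal_re, ofReal_im, zero_mul, sub_zero]
    nlinarith [mul_nonneg hε hw]
  have hge' : ∀ ε : ℝ, 0 ≤ ε → ∀ w : ℂ, 0 ≤ w.re → ε * ‖w‖ ≤ ‖1 + ε * w‖ := by
    intro ε hε w hw
    refine le_of_sq_le_sq ?_ (norm_nonneg _)
    rw [mul_pow, ← normSq_eq_norm_sq, ← normSq_eq_norm_sq, normSq_apply, normSq_apply]
    simp only [add_re, one_re, mul_re, ofReal_re, ofReal_im, zero_mul, sub_zero, add_im, one_im,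
      mul_im, zero_add, add_zero]
    nlinarith [mul_nonneg hε hw]
  suffices ∀ᶠ ε : ℝ in 𝓝[>] 0, ‖((1 + ε * z) ^ 2)⁻¹ • f z‖ ≤ C by
    refine le_of_tendsto (Tendsto.mono_left ?_ nhdsWithin_le_nhds) this
    have : ContinuousAt (fun ε : ℝ => ‖((1 + (ε : ℂ) * z) ^ 2)⁻¹ • f z‖) 0 := by
      refine ContinuousAt.norm (ContinuousAt.smul (ContinuousAt.inv₀ (by fun_prop) (by simp))
        continuousAt_const)
    simpa [ContinuousAt] using this
  filter_upwards [self_mem_nhdsWithin] with ε hε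
  change 0 < ε at hε
  -- The damping factor has modulus at most `1` on the half-plane, absorbs quadratic growth, and
  -- tends to `1` as `ε → 0`.
  set g : ℂ → E := fun w => ((1 + ε * w) ^ 2)⁻¹ • f w with hg
  have hgb : ∀ w : ℂ, 0 ≤ w.re → ‖g w‖ ≤ K * (1 + ε⁻¹) ^ 2 := by
    intro w hw
    have h1 := hge ε hε.le w hw
    have h2 := hge' ε hε.le w hw
    rw [hg]
    simp only [norm_smul, norm_inv, norm_pow]
    have hp : 0 < ‖1 + ε * w‖ := zero_lt_one.trans_le h1
    rw [inv_mul_le_iff₀ (by positivity)]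
    refine (hK w hw).trans ?_
    rw [mul_left_comm, ← mul_pow]
    gcongr
    have : ‖w‖ ≤ ‖1 + ε * w‖ * ε⁻¹ := by
      rw [← div_eq_mul_inv, le_div_iff₀ hε]; linarith
    rw [mul_add, mul_one]
    linarith
  change ‖g z‖ ≤ C
  refine PhragmenLindelof.right_half_plane_of_bounded_on_real (f := g) ?_ ?_ ?_ ?_ hz
  · have hden : ∀ w : ℂ, 0 ≤ w.re → (1 + ε * w) ^ 2 ≠ 0 := by
      intro w hw h0
      have h1 := hge ε hε.le w hw
      rw [pow_eq_zero_iff two_ne_zero] at h0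
      rw [h0, norm_zero] at h1
      linarith
    have hcl : closure {z : ℂ | 0 < z.re} = {z : ℂ | 0 ≤ z.re} := closure_setOfPred_lt_re 0
    refine DiffContOnCl.smul ⟨?_, ?_⟩ hd
    · intro w hw
      have := hden w (le_of_lt hw)
      exact DifferentiableAt.differentiableWithinAt (by fun_prop (disch := assumption))
    · rw [hcl]
      exact ContinuousOn.inv₀ (by fun_prop) hden
  -- As `g` is bounded, the growth condition holds with a zero coefficient in the exponent.
  · refine ⟨1, by norm_num, 0, ?_⟩
    refine Asymptotics.IsBigO.of_bound (K * (1 + ε⁻¹) ^ 2) ?_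
    refine eventually_inf_principal.2 (Eventually.of_forall fun w hw => ?_)
    simpa using hgb w (le_of_lt hw)
  · refine ⟨K * (1 + ε⁻¹) ^ 2, ?_⟩
    rw [eventually_map]
    filter_upwards [eventually_ge_atTop 0] with x hx
    exact hgb x (by simpa using hx)
  · intro t
    refine le_trans ?_ (him t)
    rw [hg]
    simp only [norm_smul, norm_inv, norm_pow]
    have h1 := hge ε hε.le (t * I) (by simp)
    exact mul_le_of_le_one_left (norm_nonneg _) (inv_le_one_of_one_le₀ (one_le_pow₀ h1))

end Contour

/-! ### Partial operators described by their graphs -/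

section Graphs

variable {E F G : Type*} [AddCommGroup E] [Module ℂ E] [AddCommGroup F] [Module ℂ F]
  [AddCommGroup G] [Module ℂ G]

theorem mem_graph_iff_exists {f : E →ₗ.[ℂ] F} {x : E} {y : F} :
    (x, y) ∈ f.graph ↔ ∃ hx : x ∈ f.domain, f ⟨x, hx⟩ = y := by
  rw [LinearPMap.mem_graph_iff]
  constructor
  · rintro ⟨⟨u, hu⟩, rfl, h⟩
    exact ⟨hu, h⟩
  · rintro ⟨hx, h⟩
    exact ⟨⟨x, hx⟩, rfl, h⟩

theorem mem_graph_prodOp {g : F →ₗ.[ℂ] G} {f : E →ₗ.[ℂ] F} {x : E} {z : G} :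
    (x, z) ∈ (prodOp g f).graph ↔ ∃ y, (x, y) ∈ f.graph ∧ (y, z) ∈ g.graph := by
  simp only [mem_graph_iff_exists]
  constructor
  · rintro ⟨⟨hx, hy⟩, rfl⟩
    exact ⟨f ⟨x, hx⟩, ⟨hx, rfl⟩, hy, rfl⟩
  · rintro ⟨y, ⟨hx, rfl⟩, hy, rfl⟩
    exact ⟨⟨hx, hy⟩, rfl⟩

theorem mem_graph_restrictTo {S : E →ₗ.[ℂ] E} {G : Submodule ℂ E} {x y : G} :
    (x, y) ∈ (restrictTo S G).graph ↔ ((x : E), (y : E)) ∈ S.graph := by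
  simp only [mem_graph_iff_exists]
  constructor
  · rintro ⟨⟨hx, hy⟩, rfl⟩
    exact ⟨hx, rfl⟩
  · rintro ⟨hx, hy⟩
    exact ⟨⟨hx, hy ▸ y.2⟩, Subtype.ext hy⟩

theorem mem_graph_neg {S : E →ₗ.[ℂ] F} {x : E} {y : F} :
    (x, y) ∈ (-S).graph ↔ (x, -y) ∈ S.graph := by
  simp only [mem_graph_iff_exists]
  exact exists_congr fun hx => by rw [LinearPMap.neg_apply, neg_eq_iff_eq_neg]

theorem mem_graph_toPMap_top {f : E →ₗ[ℂ] F} {x : E} {y : F} :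
    (x, y) ∈ (f.toPMap ⊤).graph ↔ f x = y := by
  rw [mem_graph_iff_exists]
  exact ⟨fun ⟨_, h⟩ => h, fun h => ⟨trivial, h⟩⟩

theorem mem_graph_idOp_sub {P : E →ₗ.[ℂ] E} {x y : E} :
    (x, y) ∈ (idOp E - P).graph ↔ (x, x - y) ∈ P.graph := by
  simp only [mem_graph_iff_exists]
  constructor
  · rintro ⟨hx, rfl⟩
    refine ⟨hx.2, ?_⟩
    rw [LinearPMap.sub_apply]
    change _ = x - (x - P ⟨x, hx.2⟩)
    abel
  · rintro ⟨hx, h⟩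
    refine ⟨⟨trivial, hx⟩, ?_⟩
    rw [LinearPMap.sub_apply]
    change x - P ⟨x, hx⟩ = y
    rw [h]
    abel

end Graphs

/-! ### Resolvent identity, openness of the resolvent set, analyticity -/

section ResolventAlgebra

variable {X : Type*} [NormedAddCommGroup X] [NormedSpace ℂ X]
  {S : X →ₗ.[ℂ] X} {z w : ℂ} {R Q : X →L[ℂ] X}

/-- Both inverse identities and the domain condition merge into one equivalence about the graph, the
form used in all later verifications. -/
theorem isResolventAt_iff :
    IsResolventAt S z R ↔ ∀ x y : X, (x, y) ∈ S.graph ↔ R (y - z • x) = x := by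
  constructor
  · rintro ⟨h1, h2⟩ x y
    constructor
    · rw [mem_graph_iff_exists]
      rintro ⟨hx, rfl⟩
      exact h2 ⟨x, hx⟩
    · intro h
      obtain ⟨hx, hy⟩ := h1 (y - z • x)
      rw [mem_graph_iff_exists]
      simp only [h, sub_left_inj] at hx hy
      exact ⟨hx, hy⟩
  · intro H
    refine ⟨fun x => ?_, fun x => (H _ _).1 (S.mem_graph x)⟩
    have h := (H (R x) (x + z • R x)).2 (by rw [add_sub_cancel_right])
    obtain ⟨hx, hy⟩ := mem_graph_iff_exists.1 h
    exact ⟨hx, by rw [hy, add_sub_cancel_right]⟩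

theorem IsResolventAt.mem_graph (hR : IsResolventAt S z R) (x : X) :
    (R x, x + z • R x) ∈ S.graph :=
  (isResolventAt_iff.1 hR _ _).2 (by rw [add_sub_cancel_right])

/-- First resolvent identity: apply `R (S - z) = 1` to the vector `Q x`, for which `S Q x = x + w Q
x`. -/
theorem IsResolventAt.sub_eq (hR : IsResolventAt S z R) (hQ : IsResolventAt S w Q) :
    R - Q = (z - w) • (R * Q) := by
  ext x
  have h := (isResolventAt_iff.1 hR _ _).1 (hQ.mem_graph x)
  simp only [map_sub, map_add, map_smul] at h
  change R x - Q x = (z - w) • R (Q x)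
  linear_combination (norm := module) h

theorem IsResolventAt.eq (hR : IsResolventAt S z R) (hQ : IsResolventAt S z Q) : R = Q := by
  have h := hR.sub_eq hQ
  rwa [sub_self, zero_smul, sub_eq_zero] at h

theorem IsResolventAt.commute (hR : IsResolventAt S z R) (hQ : IsResolventAt S w Q) :
    Commute R Q := by
  rcases eq_or_ne z w with rfl | hne
  · rw [hR.eq hQ]
  · have h1 := hR.sub_eq hQ
    have h2 := hQ.sub_eq hR
    rw [← neg_sub R Q, ← neg_sub z w, neg_smul, neg_inj, h1] at h2
    exact (smul_right_injective _ (sub_ne_zero.2 hne)) h2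

theorem IsResolventAt.resolventOp_eq (hR : IsResolventAt S z R) : resolventOp S z = R := by
  have hex : ∃ R : X →L[ℂ] X, IsResolventAt S z R := ⟨R, hR⟩
  rw [resolventOp, dif_pos hex]
  exact hex.choose_spec.eq hR

theorem isResolventAt_resolventOp (hz : z ∈ resolventSet S) :
    IsResolventAt S z (resolventOp S z) := by
  obtain ⟨R, hR⟩ := hz
  rwa [hR.resolventOp_eq]

theorem resolventOp_sub (hz : z ∈ resolventSet S) (hw : w ∈ resolventSet S) :
    resolventOp S z - resolventOp S w = (z - w) • (resolventOp S z * resolventOp S w) :=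
  (isResolventAt_resolventOp hz).sub_eq (isResolventAt_resolventOp hw)

theorem resolventOp_commute (hz : z ∈ resolventSet S) (hw : w ∈ resolventSet S) :
    Commute (resolventOp S z) (resolventOp S w) :=
  (isResolventAt_resolventOp hz).commute (isResolventAt_resolventOp hw)

/-- The reason is the factorization `S - w = (1 - (w - z) R)(S - z)`. -/
theorem IsResolventAt.mul_inverse (hR : IsResolventAt S z R)
    (hu : IsUnit (1 - (w - z) • R)) :
    IsResolventAt S w (R * Ring.inverse (1 - (w - z) • R)) := by
  set U := 1 - (w - z) • R with hU
  have hUQ : U * Ring.inverse U = 1 := Ring.mul_inverse_cancel _ hu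
  have hQU : Ring.inverse U * U = 1 := Ring.inverse_mul_cancel _ hu
  have hcU : R * U = U * R := by
    rw [hU, mul_sub, sub_mul, mul_smul_comm, smul_mul_assoc, mul_one, one_mul]
  have hcQ : R * Ring.inverse U = Ring.inverse U * R := by
    calc R * Ring.inverse U = Ring.inverse U * U * R * Ring.inverse U := by rw [hQU, one_mul]
      _ = Ring.inverse U * (R * U) * Ring.inverse U := by rw [hcU]; simp only [mul_assoc]
      _ = Ring.inverse U * R := by rw [mul_assoc, mul_assoc, hUQ, mul_one]
  rw [isResolventAt_iff] at hR ⊢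
  intro x y
  rw [hR, hcQ]
  have hUx : U x = x - (w - z) • R x := rfl
  have hiff : R (y - z • x) = x ↔ R (y - w • x) = U x := by
    rw [hUx, map_sub, map_sub, map_smul, map_smul]
    constructor <;> intro h
    · linear_combination (norm := module) h
    · linear_combination (norm := module) h
  rw [hiff]
  change _ ↔ Ring.inverse U (R (y - w • x)) = x
  constructor
  · intro h
    rw [h]
    exact DFunLike.congr_fun hQU x
  · intro h
    nth_rewrite 2 [← h]
    exact (DFunLike.congr_fun hUQ _).symm

variable [CompleteSpace X]

theorem eventually_isResolventAt (hR : IsResolventAt S z R) :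
    ∀ᶠ w in 𝓝 z, IsResolventAt S w (R * Ring.inverse (1 - (w - z) • R)) := by
  have hc : ContinuousAt (fun w : ℂ => 1 - (w - z) • R) z := by fun_prop
  have ho : {u : X →L[ℂ] X | IsUnit u} ∈ 𝓝 (1 - (z - z) • R) :=
    Units.isOpen.mem_nhds (by simp)
  filter_upwards [hc ho] with w hw using hR.mul_inverse hw

theorem isOpen_resolventSet : IsOpen (resolventSet S) := by
  refine isOpen_iff_mem_nhds.2 fun z hz => ?_
  filter_upwards [eventually_isResolventAt hz.choose_spec] with w hw using ⟨_, hw⟩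

theorem analyticAt_resolventOp (hz : z ∈ resolventSet S) : AnalyticAt ℂ (resolventOp S) z := by
  have hR := isResolventAt_resolventOp hz
  set R := resolventOp S z
  have h1 : AnalyticAt ℂ (fun w : ℂ => R * Ring.inverse (1 - (w - z) • R)) z := by
    refine analyticAt_const.mul ?_
    have h2 : AnalyticAt ℂ (Ring.inverse : (X →L[ℂ] X) → X →L[ℂ] X) (1 - (z - z) • R) := by
      simpa using analyticAt_inverse (𝕜 := ℂ) (1 : (X →L[ℂ] X)ˣ)
    exact AnalyticAt.comp (f := fun w : ℂ => 1 - (w - z) • R) h2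
      (analyticAt_const.sub ((analyticAt_id.sub analyticAt_const).smul analyticAt_const))
  refine h1.congr ?_
  filter_upwards [eventually_isResolventAt hR] with w hw using hw.resolventOp_eq.symm

end ResolventAlgebra

/-! ### The symmetry `S ↦ -S`, which exchanges the two half-planes -/

section Negation

variable {X : Type*} [NormedAddCommGroup X] [NormedSpace ℂ X]
  {S : X →ₗ.[ℂ] X} {z : ℂ} {R : X →L[ℂ] X}

theorem IsResolventAt.neg (hR : IsResolventAt S z R) : IsResolventAt (-S) (-z) (-R) := by
  rw [isResolventAt_iff] at hR ⊢
  intro x y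
  rw [mem_graph_neg, hR]
  have : (-R) (y - -z • x) = R (-y - z • x) := by
    change -R (y - -z • x) = _
    rw [← map_neg]
    congr 1
    module
  rw [this]

theorem neg_mem_resolventSet_neg : -z ∈ resolventSet (-S) ↔ z ∈ resolventSet S := by
  constructor
  · rintro ⟨R, hR⟩
    have := hR.neg
    rw [neg_neg, neg_neg] at this
    exact ⟨_, this⟩
  · rintro ⟨R, hR⟩
    exact ⟨_, hR.neg⟩

theorem mem_resolventSet_neg : z ∈ resolventSet (-S) ↔ -z ∈ resolventSet S := by
  rw [← neg_mem_resolventSet_neg, neg_neg]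

theorem resolventOp_neg (S : X →ₗ.[ℂ] X) (z : ℂ) :
    resolventOp (-S) z = -resolventOp S (-z) := by
  by_cases hz : -z ∈ resolventSet S
  · have := (isResolventAt_resolventOp hz).neg
    rw [neg_neg] at this
    exact this.resolventOp_eq
  -- Off the resolvent set both sides are the default value `0`.
  · have hz' : z ∉ resolventSet (-S) := fun h => hz (mem_resolventSet_neg.1 h)
    rw [resolventOp, resolventOp, dif_neg (show ¬∃ R, IsResolventAt S (-z) R from hz),
      dif_neg (show ¬∃ R, IsResolventAt (-S) z R from hz'), neg_zero]

theorem restrictTo_neg (S : X →ₗ.[ℂ] X) (G : Submodule ℂ X) :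
    restrictTo (-S) G = -restrictTo S G := by
  refine LinearPMap.eq_of_eq_graph ?_
  ext ⟨x, y⟩
  rw [mem_graph_restrictTo, mem_graph_neg, mem_graph_neg, mem_graph_restrictTo]
  rfl

theorem sqOp_neg (S : X →ₗ.[ℂ] X) : sqOp (-S) = sqOp S := by
  refine LinearPMap.eq_of_eq_graph ?_
  ext ⟨x, y⟩
  simp only [sqOp, mem_graph_prodOp, mem_graph_neg]
  constructor
  · rintro ⟨u, h1, h2⟩
    refine ⟨-u, h1, ?_⟩
    simpa using neg_mem h2
  · rintro ⟨u, h1, h2⟩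
    refine ⟨-u, by simpa using h1, ?_⟩
    simpa using neg_mem h2

theorem boundedExtensionSpace_neg_le (S : X →ₗ.[ℂ] X) (H : Set ℂ) :
    boundedExtensionSpace S H ≤ boundedExtensionSpace (-S) (-H) := by
  rintro x ⟨φ, hφ, hφe, C, hC⟩
  refine ⟨fun z => -φ (-z), ?_, fun z hz => ?_, C, fun z hz => ?_⟩
  · intro z hz
    refine AnalyticAt.neg (AnalyticAt.comp (g := φ) (hφ (-z) ?_) analyticAt_id.neg)
    rcases hz with hz | hz
    · exact Or.inl hz
    · exact Or.inr (mem_resolventSet_neg.1 hz)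
  · rw [resolventOp_neg, neg_apply, ← hφe _ (mem_resolventSet_neg.1 hz)]
  · rw [norm_neg]
    exact hC _ hz

theorem boundedExtensionSpace_neg (S : X →ₗ.[ℂ] X) (H : Set ℂ) :
    boundedExtensionSpace (-S) H = boundedExtensionSpace S (-H) := by
  apply le_antisymm
  · simpa using boundedExtensionSpace_neg_le (-S) H
  · simpa using boundedExtensionSpace_neg_le S (-H)

theorem Gplus_neg (S : X →ₗ.[ℂ] X) : Gplus (-S) = Gminus S := by
  rw [Gplus, boundedExtensionSpace_neg, Gminus]
  congr 1
  ext z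
  simp

theorem Gminus_neg (S : X →ₗ.[ℂ] X) : Gminus (-S) = Gplus S := by
  rw [← Gplus_neg, neg_neg]

theorem kernelA_neg (S : X →ₗ.[ℂ] X) (z : ℂ) : kernelA (-S) z = -kernelA S (-z) := by
  rw [kernelA, kernelA, resolventOp_neg, neg_sq, smul_neg]

/-- No sign appears: `z ↦ -z` changes the sign of `dz` and also reverses the orientation of the
line. -/
theorem lineIntegral_comp_neg {E : Type*} [NormedAddCommGroup E] [NormedSpace ℂ E] (f : ℂ → E)
    (a : ℝ) : lineIntegral (fun z => f (-z)) a = lineIntegral f (-a) := by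
  rw [lineIntegral, lineIntegral, ← integral_neg_eq_self]
  congr 1
  ext t
  congr 2
  push_cast
  ring

theorem Aplus_neg (S : X →ₗ.[ℂ] X) (h : ℝ) : Aplus (-S) h = Aminus S h := by
  have h1 : kernelA (-S) = fun z => -kernelA S (-z) := funext (kernelA_neg S)
  have h2 : lineIntegral (kernelA (-S)) h = -lineIntegral (kernelA S) (-h) := by
    rw [h1, ← lineIntegral_comp_neg, lineIntegral, lineIntegral, ← integral_neg]
    simp only [smul_neg]
  rw [Aplus, Aminus, h2, smul_neg, ← neg_smul, neg_div]

theorem Aminus_neg (S : X →ₗ.[ℂ] X) (h : ℝ) : Aminus (-S) h = Aplus S h := by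
  rw [← Aplus_neg, neg_neg]

theorem Pplus_neg (S : X →ₗ.[ℂ] X) (h : ℝ) : Pplus (-S) h = Pminus S h := by
  rw [Pplus, Pminus, sqOp_neg, Aplus_neg]

end Negation

/-! ### Bounded strip, commutation, and the identity `A₊ + A₋ = R(0)²` -/

section Splitting

theorem ne_zero_of_line {a : ℝ} (ha : a ≠ 0) (t : ℝ) : (a : ℂ) + t * I ≠ 0 := by
  intro h0
  have := congrArg re h0
  simp at this
  exact ha this

variable {X : Type*} [NormedAddCommGroup X] [NormedSpace ℂ X]

/-- The closed strip `|Re z| ≤ h` lies in the resolvent set of `S` and the resolvent is bounded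
by `M` on it. -/
structure HasBoundedStrip (S : X →ₗ.[ℂ] X) (h M : ℝ) : Prop where
  pos : 0 < h
  mem : ∀ z : ℂ, |z.re| ≤ h → z ∈ resolventSet S
  norm_le : ∀ z : ℂ, |z.re| ≤ h → ‖resolventOp S z‖ ≤ M

namespace HasBoundedStrip

variable {S : X →ₗ.[ℂ] X} {h M : ℝ}

theorem neg (H : HasBoundedStrip S h M) : HasBoundedStrip (-S) h M where
  pos := H.pos
  mem z hz := mem_resolventSet_neg.2 (H.mem _ (by simpa using hz))
  norm_le z hz := by
    rw [resolventOp_neg, norm_neg]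
    exact H.norm_le _ (by simpa using hz)

theorem zero_mem (H : HasBoundedStrip S h M) : 0 ∈ resolventSet S :=
  H.mem 0 (by simpa using H.pos.le)

theorem nonneg (H : HasBoundedStrip S h M) : 0 ≤ M :=
  (norm_nonneg _).trans (H.norm_le 0 (by simpa using H.pos.le))

/-- This trades the unbounded `S` for its bounded inverse in everything that follows. -/
theorem mem_graph_iff (H : HasBoundedStrip S h M) {x y : X} :
    (x, y) ∈ S.graph ↔ resolventOp S 0 y = x := by
  rw [isResolventAt_iff.1 (isResolventAt_resolventOp H.zero_mem), zero_smul, sub_zero]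

theorem mem_graph_sqOp_iff (H : HasBoundedStrip S h M) {x y : X} :
    (x, y) ∈ (sqOp S).graph ↔ resolventOp S 0 (resolventOp S 0 y) = x := by
  rw [sqOp, mem_graph_prodOp]
  simp only [H.mem_graph_iff]
  constructor
  · rintro ⟨u, h1, h2⟩
    rw [h2, h1]
  · intro h1
    exact ⟨_, h1, rfl⟩

theorem resolvent_zero_injective (H : HasBoundedStrip S h M) :
    Function.Injective (resolventOp S 0) := by
  rw [injective_iff_map_eq_zero]
  intro y hy
  obtain ⟨hx, h1⟩ := mem_graph_iff_exists.1 (H.mem_graph_iff.2 hy)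
  rw [← h1]
  exact S.map_zero

/-- With `0 ∈ ϱ(S)`, the resolvent at `z` is characterised by two bounded operator equations. -/
theorem isResolventAt_iff_mul (H : HasBoundedStrip S h M) {z : ℂ} {R : X →L[ℂ] X} :
    IsResolventAt S z R ↔ R = resolventOp S 0 + z • (R * resolventOp S 0) ∧
      R = resolventOp S 0 + z • (resolventOp S 0 * R) := by
  constructor
  · intro hR
    have h0 := isResolventAt_resolventOp H.zero_mem
    have h1 := hR.sub_eq h0
    rw [sub_zero] at h1
    refine ⟨eq_add_of_sub_eq' h1, ?_⟩
    rw [← (hR.commute h0).eq]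
    exact eq_add_of_sub_eq' h1
  · rintro ⟨h1, h2⟩
    rw [isResolventAt_iff]
    intro x y
    rw [H.mem_graph_iff]
    have e1 : ∀ u, R u = resolventOp S 0 u + z • R (resolventOp S 0 u) := DFunLike.congr_fun h1
    have e2 : ∀ u, R u = resolventOp S 0 u + z • resolventOp S 0 (R u) := DFunLike.congr_fun h2
    constructor
    · rintro rfl
      rw [map_sub, map_smul, e1 y, add_sub_cancel_right]
    · intro hx
      have h3 := e2 (y - z • x)
      rw [hx, map_sub, map_smul] at h3
      rw [h3]
      module

end HasBoundedStrip

theorem commute_lineIntegral {T : X →L[ℂ] X} {f : ℂ → X →L[ℂ] X} {a : ℝ}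
    (hT : ∀ t : ℝ, Commute T (f (a + t * I))) : Commute T (lineIntegral f a) := by
  rw [lineIntegral, integral_smul]
  refine Commute.smul_right ?_ _
  by_cases hf : Integrable fun t : ℝ => f (a + t * I)
  · rw [Commute, SemiconjBy, ← integral_const_mul_of_integrable hf,
      ← integral_mul_const_of_integrable hf]
    exact integral_congr_ae (Eventually.of_forall fun t => hT t)
  -- A non-integrable integrand gives the integral `0`, which commutes with everything.
  · rw [integral_undef hf]
    exact Commute.zero_right _

theorem lineIntegral_apply {f : ℂ → X →L[ℂ] X} {a : ℝ}
    (hf : Integrable fun t : ℝ => f (a + t * I)) (x : X) :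
    lineIntegral f a x = lineIntegral (fun z => f z x) a := by
  exact ContinuousLinearMap.integral_apply (φ := fun t : ℝ => I • f (a + t * I)) (hf.smul I) x

namespace HasBoundedStrip

variable {S : X →ₗ.[ℂ] X} {h M : ℝ}

theorem resolventOp_commute_Aplus (H : HasBoundedStrip S h M) {z : ℂ} (hz : z ∈ resolventSet S) :
    Commute (resolventOp S z) (Aplus S h) :=
  Commute.smul_right (commute_lineIntegral fun _ => Commute.smul_right (resolventOp_commute hz
    (H.mem _ (by simpa using (abs_of_pos H.pos).le))) _) _

theorem resolventOp_commute_Aminus (H : HasBoundedStrip S h M) {z : ℂ}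
    (hz : z ∈ resolventSet S) : Commute (resolventOp S z) (Aminus S h) := by
  have := H.neg.resolventOp_commute_Aplus (neg_mem_resolventSet_neg.2 hz)
  rw [resolventOp_neg, neg_neg, Aplus_neg] at this
  exact Commute.neg_left_iff.1 this

/-- Iterating `R(z) = R(0) + z R(z) R(0)` once gives the second-order expansion at `0`. Divided by
`z²`, it isolates the singular part of `kernelA`. -/
theorem resolventOp_eq_expansion (H : HasBoundedStrip S h M) {z : ℂ} (hz : z ∈ resolventSet S) :
    resolventOp S z = resolventOp S 0 + z • (resolventOp S 0 * resolventOp S 0) +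
      z ^ 2 • (resolventOp S z * (resolventOp S 0 * resolventOp S 0)) := by
  have h1 := (H.isResolventAt_iff_mul.1 (isResolventAt_resolventOp hz)).1
  nth_rewrite 1 [h1]
  nth_rewrite 1 [h1]
  rw [add_mul, smul_add, smul_mul_assoc, smul_smul, mul_assoc, add_assoc, pow_two z]

end HasBoundedStrip

variable [CompleteSpace X] {S : X →ₗ.[ℂ] X} {h M : ℝ}

namespace HasBoundedStrip

theorem continuous_resolventOp_line (H : HasBoundedStrip S h M) {a : ℝ} (ha : |a| ≤ h) :
    Continuous fun t : ℝ => resolventOp S (a + t * I) := by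
  refine continuous_iff_continuousAt.2 fun t => ?_
  refine ContinuousAt.comp (g := resolventOp S)
    (analyticAt_resolventOp (H.mem _ (by simpa))).continuousAt ?_
  fun_prop

theorem integrable_smul_resolventOp (H : HasBoundedStrip S h M) {a : ℝ} (ha : |a| ≤ h)
    (ha0 : a ≠ 0) {c : ℂ → ℂ} {C : ℝ} (hc : Continuous fun t : ℝ => c (a + t * I))
    (hC : ∀ t : ℝ, ‖c (a + t * I)‖ ≤ C * (a ^ 2 + t ^ 2)⁻¹) :
    Integrable fun t : ℝ => c (a + t * I) • resolventOp S (a + t * I) := by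
  refine integrable_vertical (F := fun z => c z • resolventOp S z) (C := C * M) ha0
    (hc.smul (H.continuous_resolventOp_line ha)) fun t => ?_
  rw [norm_smul, mul_right_comm]
  exact mul_le_mul (hC t) (H.norm_le _ (by simpa)) (norm_nonneg _)
    ((norm_nonneg _).trans (hC t))

theorem integrable_kernelA (H : HasBoundedStrip S h M) {a : ℝ} (ha : |a| ≤ h) (ha0 : a ≠ 0) :
    Integrable fun t : ℝ => kernelA S (a + t * I) := by
  refine H.integrable_smul_resolventOp ha ha0 (c := fun z => 1 / z ^ 2) (C := 1) ?_ fun t => ?_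
  · refine continuous_const.div (by fun_prop) fun t => pow_ne_zero 2 (ne_zero_of_line ha0 t)
  · rw [norm_div, norm_pow, norm_sq_add_mul_I, norm_one, one_div, one_mul]

/-- This is the residue of `z⁻² R(z)` at `0`. Since `z⁻² R(z)` itself is singular in the strip, its
singular part is integrated explicitly and only the holomorphic remainder `R(z) R(0)²` is shifted.
-/
theorem Aplus_add_Aminus (H : HasBoundedStrip S h M) :
    Aplus S h + Aminus S h = resolventOp S 0 * resolventOp S 0 := by
  set Q := resolventOp S 0 * resolventOp S 0 with hQ
  have hp : |h| ≤ h := (abs_of_pos H.pos).le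
  have hm : |-h| ≤ h := by rwa [abs_neg]
  have hne : h ≠ 0 := H.pos.ne'
  have hip := H.integrable_kernelA hp hne
  have him := H.integrable_kernelA hm (neg_ne_zero.2 hne)
  set g : ℂ → X →L[ℂ] X := fun z => resolventOp S z * Q with hg
  have hk : ∀ z : ℂ, |z.re| ≤ h → z ≠ 0 →
      kernelA S z = (1 / z ^ 2) • resolventOp S 0 + z⁻¹ • Q + g z := by
    intro z hz hz0
    rw [kernelA]
    nth_rewrite 1 [H.resolventOp_eq_expansion (H.mem z hz)]
    rw [smul_add, smul_add, smul_smul, smul_smul]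
    congr 2
    · congr 1
      field_simp
    · rw [one_div, inv_mul_cancel₀ (pow_ne_zero 2 hz0), one_smul]
  have hinvsq : ∀ a : ℝ, a ≠ 0 → Integrable fun t : ℝ => 1 / ((a : ℂ) + t * I) ^ 2 := by
    intro a ha
    refine integrable_vertical (F := fun z : ℂ => 1 / z ^ 2) (C := 1) ha ?_ fun t => ?_
    · exact continuous_const.div (by fun_prop) fun t => pow_ne_zero 2 (ne_zero_of_line ha t)
    · rw [norm_div, norm_pow, norm_sq_add_mul_I, norm_one, one_div, one_mul]
  have hinvsq_eq : ∫ t : ℝ, 1 / ((h : ℂ) + t * I) ^ 2 =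
      ∫ t : ℝ, 1 / (((-h : ℝ) : ℂ) + t * I) ^ 2 := by
    rw [← integral_neg_eq_self]
    congr 1
    ext t
    congr 1
    push_cast
    ring
  -- The `z⁻²` terms cancel after integration by `t ↦ -t`, the `z⁻¹` terms combine to the Poisson
  -- kernel `2h/(h² + t²)` of mass `2π`, and the `g` terms integrate to zero.
  have hdiff : ∀ t : ℝ, kernelA S (h + t * I) - kernelA S ((-h : ℝ) + t * I) =
      (1 / ((h : ℂ) + t * I) ^ 2 - 1 / (((-h : ℝ) : ℂ) + t * I) ^ 2) • resolventOp S 0 +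
      ((2 * h * (h ^ 2 + t ^ 2)⁻¹ : ℝ) : ℂ) • Q + (g (h + t * I) - g ((-h : ℝ) + t * I)) := by
    intro t
    have hp0 := ne_zero_of_line hne t
    have hm0 := ne_zero_of_line (neg_ne_zero.2 hne) t
    have hsc : ((2 * h * (h ^ 2 + t ^ 2)⁻¹ : ℝ) : ℂ) =
        ((h : ℂ) + t * I)⁻¹ - (((-h : ℝ) : ℂ) + t * I)⁻¹ := by
      have hprod : ((h ^ 2 + t ^ 2 : ℝ) : ℂ) = -(((h : ℂ) + t * I) * (((-h : ℝ) : ℂ) + t * I)) := by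
        push_cast
        linear_combination ((t : ℂ) ^ 2) * I_sq
      rw [ofReal_mul, ofReal_inv, hprod]
      field_simp
      push_cast
      ring
    rw [hk _ (by simpa using hp) hp0, hk _ (by simpa using hp) hm0, hsc]
    module
  have hi1 : Integrable fun t : ℝ =>
      (1 / ((h : ℂ) + t * I) ^ 2 - 1 / (((-h : ℝ) : ℂ) + t * I) ^ 2) • resolventOp S 0 :=
    ((hinvsq h hne).sub (hinvsq (-h) (neg_ne_zero.2 hne))).smul_const _
  have hi2 : Integrable fun t : ℝ => ((2 * h * (h ^ 2 + t ^ 2)⁻¹ : ℝ) : ℂ) • Q :=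
    (((integrable_inv_sq_add_sq hne).const_mul (2 * h)).ofReal).smul_const _
  have hi3 : Integrable fun t : ℝ => g (h + t * I) - g ((-h : ℝ) + t * I) := by
    refine (((hip.sub him).sub hi1).sub hi2).congr (Eventually.of_forall fun t => ?_)
    simp only [Pi.sub_apply, hdiff]
    abel
  have hg0 : ∫ t : ℝ, (g (h + t * I) - g ((-h : ℝ) + t * I)) = 0 := by
    -- The constant adds the bound `M ‖Q‖` for `|Im z| ≤ 1` to the bound `2 M + ‖Q‖` for `|Im z| ≥
    -- 1`.
    refine integral_strip_sub_eq_zero (C := 2 * M + ‖Q‖ + M * ‖Q‖) (by linarith [H.pos])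
      (fun z hz hz' => ?_) (fun z hz hz' => ?_) hi3
    · exact (analyticAt_resolventOp (H.mem z (abs_le.2 ⟨hz, hz'⟩))).differentiableAt.mul_const Q
    · have hzh : |z.re| ≤ h := abs_le.2 ⟨hz, hz'⟩
      have hM := H.nonneg
      have hgM : ‖g z‖ ≤ M * ‖Q‖ :=
        (norm_mul_le _ _).trans (mul_le_mul_of_nonneg_right (H.norm_le z hzh) (norm_nonneg _))
      rcases le_total |z.im| 1 with hi | hi
      · have : |z.im| * ‖g z‖ ≤ 1 * ‖g z‖ := mul_le_mul_of_nonneg_right hi (norm_nonneg _)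
        linarith [norm_nonneg Q]
      · have hz1 : 1 ≤ ‖z‖ := hi.trans (abs_im_le_norm z)
        -- The expansion read backwards shows that `g` decays like `1/|z|`.
        have hexp : z ^ 2 • g z = resolventOp S z - resolventOp S 0 - z • Q := by
          rw [sub_sub]
          exact eq_sub_of_add_eq' (H.resolventOp_eq_expansion (H.mem z hzh)).symm
        have h1 : ‖z‖ ^ 2 * ‖g z‖ ≤ M + M + ‖z‖ * ‖Q‖ := by
          rw [← norm_pow, ← norm_smul, hexp]
          refine (norm_sub_le _ _).trans (add_le_add ((norm_sub_le _ _).trans (add_le_add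
            (H.norm_le z hzh) (H.norm_le 0 (by simpa using H.pos.le)))) (norm_smul _ _).le)
        have h2 : ‖z‖ * ‖g z‖ ≤ 2 * M + ‖Q‖ := by
          refine le_of_mul_le_mul_left ?_ (zero_lt_one.trans_le hz1)
          nlinarith
        have h3 : |z.im| * ‖g z‖ ≤ ‖z‖ * ‖g z‖ :=
          mul_le_mul_of_nonneg_right (abs_im_le_norm z) (norm_nonneg _)
        linarith [mul_nonneg hM (norm_nonneg Q)]
  have hmain : ∫ t : ℝ, (kernelA S (h + t * I) - kernelA S ((-h : ℝ) + t * I)) =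
      (2 * (Real.pi : ℂ)) • Q := by
    simp only [hdiff]
    rw [integral_add (by exact hi1.add hi2) hi3, integral_add hi1 hi2, hg0, integral_smul_const,
      integral_smul_const, integral_sub (hinvsq h hne) (hinvsq (-h) (neg_ne_zero.2 hne)),
      hinvsq_eq, sub_self, zero_smul, zero_add, add_zero, integral_complex_ofReal, integral_const_mul,
      integral_inv_sq_add_sq H.pos]
    congr 1
    rw [← ofReal_ofNat, ← ofReal_mul, ofReal_inj]
    field_simp
  rw [integral_sub hip him] at hmain
  rw [Aplus, Aminus, lineIntegral, lineIntegral, integral_smul, integral_smul, neg_div, neg_smul,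
    ← sub_eq_add_neg, ← smul_sub, ← smul_sub, hmain, smul_smul, smul_smul]
  have hpi : (Real.pi : ℂ) ≠ 0 := ofReal_ne_zero.2 Real.pi_ne_zero
  have : 1 / (2 * (Real.pi : ℂ) * I) * I * (2 * (Real.pi : ℂ)) = 1 := by
    field_simp
  rw [this, one_smul]

end HasBoundedStrip
end Splitting

/-! ### The Cauchy integral extending the resolvent, and `G₊ = ker A₋` -/

section Extension

variable {X : Type*} [NormedAddCommGroup X] [NormedSpace ℂ X]

/-- The operator `1/(2πi) ∫_{h-i∞}^{h+i∞} w⁻² (w - z)⁻¹ (S - w)⁻¹ dw`. -/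
def cauchyTransform (S : X →ₗ.[ℂ] X) (h : ℝ) (z : ℂ) : X →L[ℂ] X :=
  (1 / (2 * (Real.pi : ℂ) * I)) •
    lineIntegral (fun w => (1 / (w ^ 2 * (w - z))) • resolventOp S w) h

/-- On `ker A₋`, this operator extends the resolvent `(S - z)⁻¹` to `Re z < h`. -/
def extendedResolvent (S : X →ₗ.[ℂ] X) (h : ℝ) (z : ℂ) : X →L[ℂ] X :=
  z ^ 2 • cauchyTransform S h z + resolventOp S 0 + z • (resolventOp S 0 * resolventOp S 0)

theorem sub_re_le_norm_line_sub (h t : ℝ) (z : ℂ) : h - z.re ≤ ‖(h : ℂ) + t * I - z‖ := by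
  refine le_trans (le_of_eq ?_) ((le_abs_self _).trans (abs_re_le_norm _))
  simp

theorem line_sub_ne_zero {h : ℝ} {z : ℂ} (hz : z.re < h) (t : ℝ) : (h : ℂ) + t * I - z ≠ 0 := by
  rw [← norm_pos_iff]
  exact (sub_pos.2 hz).trans_le (sub_re_le_norm_line_sub h t z)

theorem isOpen_re_lt (h : ℝ) : IsOpen {z : ℂ | z.re < h} :=
  isOpen_lt continuous_re continuous_const

/-- The case `n = 1` serves the transform itself, `n = 2` its derivative in `z`. -/
theorem HasBoundedStrip.norm_cauchyKernel_le {S : X →ₗ.[ℂ] X} {h M : ℝ} (H : HasBoundedStrip S h M) {z : ℂ} {d : ℝ} (hd : 0 < d)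
    (hz : z.re + d ≤ h) (n : ℕ) (t : ℝ) :
    ‖I • (1 / (((h : ℂ) + t * I) ^ 2 * ((h : ℂ) + t * I - z) ^ n)) •
      resolventOp S (h + t * I)‖ ≤ (d ^ n)⁻¹ * M * (h ^ 2 + t ^ 2)⁻¹ := by
  have h1 := sub_re_le_norm_line_sub h t z
  have h2 : d ≤ ‖(h : ℂ) + t * I - z‖ := by linarith
  have h3 := H.norm_le (h + t * I) (by simpa using (abs_of_pos H.pos).le)
  have h4 := H.nonneg
  rw [norm_smul, norm_I, one_mul, norm_smul, norm_div, norm_mul, norm_pow, norm_pow,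
    norm_sq_add_mul_I, norm_one, one_div, mul_inv]
  calc _ ≤ ((h ^ 2 + t ^ 2)⁻¹ * (d ^ n)⁻¹) * M := by gcongr
    _ = _ := by ring

theorem HasBoundedStrip.exists_norm_cauchyTransform_le {S : X →ₗ.[ℂ] X} {h M : ℝ} (H : HasBoundedStrip S h M) :
    ∃ K : ℝ, 0 ≤ K ∧ ∀ z : ℂ, z.re ≤ 0 → ‖cauchyTransform S h z‖ ≤ K := by
  refine ⟨‖1 / (2 * (Real.pi : ℂ) * I)‖ * ∫ t : ℝ, (h ^ 1)⁻¹ * M * (h ^ 2 + t ^ 2)⁻¹, ?_,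
    fun z hz => ?_⟩
  · have := H.nonneg
    have := H.pos
    refine mul_nonneg (norm_nonneg _) (integral_nonneg fun t => ?_)
    positivity
  · rw [cauchyTransform, norm_smul]
    refine mul_le_mul_of_nonneg_left ?_ (norm_nonneg _)
    refine norm_integral_le_of_norm_le ((integrable_inv_sq_add_sq H.pos.ne').const_mul _)
      (Eventually.of_forall fun t => ?_)
    simpa using H.norm_cauchyKernel_le H.pos (by linarith : z.re + h ≤ h) 1 t

variable [CompleteSpace X] {S : X →ₗ.[ℂ] X} {h M : ℝ}

/-- The half-plane `Re z < h` and `ϱ(S)` are open, so `ψ` and the resolvent, agreeing on the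
overlap, glue to an analytic function. -/
theorem mem_Gplus_of_extension (hh : 0 < h) {x : X} {ψ : ℂ → X}
    (hψ : DifferentiableOn ℂ ψ {z | z.re < h})
    (heq : ∀ z ∈ resolventSet S, z.re < h → ψ z = resolventOp S z x)
    (hb : ∃ C : ℝ, ∀ z : ℂ, z.re ≤ 0 → ‖ψ z‖ ≤ C) : x ∈ Gplus S := by
  classical
  obtain ⟨C, hC⟩ := hb
  refine ⟨fun z => if z.re < h then ψ z else resolventOp S z x, ?_, fun z hz => ?_, C,
    fun z hz => ?_⟩
  · rintro z (hz | hz)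
    · have hzh : z.re < h := lt_of_le_of_lt hz hh
      refine (hψ.analyticAt ((isOpen_re_lt h).mem_nhds hzh)).congr ?_
      filter_upwards [(isOpen_re_lt h).mem_nhds hzh] with w hw
      rw [if_pos hw]
    · have h1 : AnalyticAt ℂ (fun w => resolventOp S w x) z :=
        ((ContinuousLinearMap.apply ℂ X x).analyticAt _).comp (analyticAt_resolventOp hz)
      refine h1.congr ?_
      filter_upwards [isOpen_resolventSet.mem_nhds hz] with w hw
      split_ifs with hwh
      · exact (heq w hw hwh).symm
      · rfl
  · dsimp only
    split_ifs with hzh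
    · exact heq z hz hzh
    · rfl
  · have hzh : z.re < h := lt_of_le_of_lt hz hh
    dsimp only
    rw [if_pos hzh]
    exact hC z hz

namespace HasBoundedStrip

theorem integrable_cauchyKernel (H : HasBoundedStrip S h M) {z : ℂ} (hz : z.re < h) (n : ℕ) :
    Integrable fun t : ℝ => (1 / (((h : ℂ) + t * I) ^ 2 * ((h : ℂ) + t * I - z) ^ n)) •
      resolventOp S (h + t * I) := by
  have hne : h ≠ 0 := H.pos.ne'
  refine H.integrable_smul_resolventOp (abs_of_pos H.pos).le hne
    (c := fun w => 1 / (w ^ 2 * (w - z) ^ n)) (C := ((h - z.re) ^ n)⁻¹) ?_ fun t => ?_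
  · exact continuous_const.div (by fun_prop) fun t =>
      mul_ne_zero (pow_ne_zero 2 (ne_zero_of_line hne t)) (pow_ne_zero n (line_sub_ne_zero hz t))
  · have h1 := sub_re_le_norm_line_sub h t z
    have h2 := sub_pos.2 hz
    rw [norm_div, norm_mul, norm_pow, norm_pow, norm_sq_add_mul_I, norm_one, one_div, mul_inv,
      mul_comm]
    gcongr

theorem differentiableAt_cauchyTransform (H : HasBoundedStrip S h M) {z : ℂ} (hz : z.re < h) :
    DifferentiableAt ℂ (cauchyTransform S h) z := by
  suffices hL : DifferentiableAt ℂ (fun z => lineIntegral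
      (fun w => (1 / (w ^ 2 * (w - z))) • resolventOp S w) h) z from
    hL.const_smul (1 / (2 * (Real.pi : ℂ) * I))
  -- With half the distance to the contour as radius, every point of the ball stays at distance at
  -- least `d` from the contour.
  set d := (h - z.re) / 2 with hd
  have hd0 : 0 < d := by have := sub_pos.2 hz; positivity
  have hball : ∀ w ∈ Metric.ball z d, w.re + d ≤ h := by
    intro w hw
    rw [Metric.mem_ball, dist_eq_norm] at hw
    have := (le_abs_self _).trans (abs_re_le_norm (w - z))
    rw [sub_re] at this
    linarith
  have hballh : ∀ w ∈ Metric.ball z d, w.re < h := fun w hw => by linarith [hball w hw]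
  have hint1 : ∀ w ∈ Metric.ball z d, Integrable fun t : ℝ =>
      I • (1 / (((h : ℂ) + t * I) ^ 2 * ((h : ℂ) + t * I - w))) • resolventOp S (h + t * I) :=
    fun w hw => by simpa using! (H.integrable_cauchyKernel (hballh w hw) 1).smul I
  have hint2 : Integrable fun t : ℝ =>
      I • (1 / (((h : ℂ) + t * I) ^ 2 * ((h : ℂ) + t * I - z) ^ 2)) • resolventOp S (h + t * I) :=
    (H.integrable_cauchyKernel hz 2).smul I
  have hz_mem : z ∈ Metric.ball z d := Metric.mem_ball_self hd0
  refine (hasDerivAt_integral_of_dominated_loc_of_deriv_le (μ := volume)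
    (F := fun (w : ℂ) (t : ℝ) =>
      I • (1 / (((h : ℂ) + t * I) ^ 2 * ((h : ℂ) + t * I - w))) • resolventOp S (h + t * I))
    (F' := fun (w : ℂ) (t : ℝ) =>
      I • (1 / (((h : ℂ) + t * I) ^ 2 * ((h : ℂ) + t * I - w) ^ 2)) • resolventOp S (h + t * I))
    (bound := fun t => (d ^ 2)⁻¹ * M * (h ^ 2 + t ^ 2)⁻¹)
    (Metric.ball_mem_nhds z hd0) ?_ (hint1 z hz_mem)
    hint2.aestronglyMeasurable ?_ ?_ ?_).2.differentiableAt
  · filter_upwards [Metric.ball_mem_nhds z hd0] with w hw using (hint1 w hw).aestronglyMeasurable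
  · exact Eventually.of_forall fun t w hw => H.norm_cauchyKernel_le hd0 (hball w hw) 2 t
  · exact (integrable_inv_sq_add_sq H.pos.ne').const_mul _
  · refine Eventually.of_forall fun t w hw => ?_
    have hw0 := line_sub_ne_zero (hballh w hw) t
    have hl0 := ne_zero_of_line H.pos.ne' t
    have h1 : HasDerivAt (fun w : ℂ => ((h : ℂ) + t * I) ^ 2 * ((h : ℂ) + t * I - w))
        (((h : ℂ) + t * I) ^ 2 * (-1)) w :=
      ((hasDerivAt_id w).const_sub _).const_mul _
    have h2 := h1.inv (mul_ne_zero (pow_ne_zero 2 hl0) hw0)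
    have h3 : HasDerivAt (fun w : ℂ => 1 / (((h : ℂ) + t * I) ^ 2 * ((h : ℂ) + t * I - w)))
        (1 / (((h : ℂ) + t * I) ^ 2 * ((h : ℂ) + t * I - w) ^ 2)) w := by
      simp only [one_div]
      convert! h2 using 1
      field_simp
    exact (h3.smul_const (resolventOp S (h + t * I))).const_smul I

/-- By the resolvent identity `R(z) R(w) = (R(w) - R(z))/(w - z)`. The `R(z)` part carries the
scalar integral of `1/(w² (w - z))`, which vanishes because both poles lie to the left of the
contour. -/
theorem resolventOp_mul_Aplus (H : HasBoundedStrip S h M) {z : ℂ} (hz : z ∈ resolventSet S)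
    (hzh : z.re < h) : resolventOp S z * Aplus S h = cauchyTransform S h z := by
  have hp : |h| ≤ h := (abs_of_pos H.pos).le
  have hi0 : Integrable fun t : ℝ => 1 / (((h : ℂ) + t * I) ^ 2 * ((h : ℂ) + t * I - z)) := by
    refine integrable_vertical (F := fun w => 1 / (w ^ 2 * (w - z))) (C := (h - z.re)⁻¹)
      H.pos.ne' ?_ fun t => ?_
    · exact continuous_const.div (by fun_prop) fun t =>
        mul_ne_zero (pow_ne_zero 2 (ne_zero_of_line H.pos.ne' t)) (line_sub_ne_zero hzh t)
    · have h1 := sub_re_le_norm_line_sub h t z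
      have h2 := sub_pos.2 hzh
      rw [norm_div, norm_mul, norm_pow, norm_sq_add_mul_I, norm_one, one_div, mul_inv, mul_comm]
      gcongr
  have hzero : ∫ t : ℝ, 1 / (((h : ℂ) + t * I) ^ 2 * ((h : ℂ) + t * I - z)) = 0 := by
    have hne : ∀ w : ℂ, h ≤ w.re → w ^ 2 * (w - z) ≠ 0 := by
      intro w hw
      refine mul_ne_zero (pow_ne_zero 2 ?_) ?_
      · rintro rfl
        exact absurd hw (by simpa using H.pos)
      · intro h0
        have := congrArg re h0
        simp at this
        linarith
    refine integral_vertical_eq_zero (F := fun w => 1 / (w ^ 2 * (w - z))) (C := (h - z.re)⁻¹)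
      H.pos (fun w hw => ?_) fun w hw => ?_
    · exact (differentiableAt_const _).div (by fun_prop) (hne w hw)
    · have h1 : h - z.re ≤ ‖w - z‖ := by
        refine le_trans ?_ ((le_abs_self _).trans (abs_re_le_norm _))
        simpa using hw
      have h2 := sub_pos.2 hzh
      rw [norm_div, norm_mul, norm_pow, norm_one, one_div, mul_inv, mul_comm]
      gcongr
  have hi1 : Integrable fun t : ℝ => (1 / (((h : ℂ) + t * I) ^ 2 * ((h : ℂ) + t * I - z))) •
      resolventOp S (h + t * I) := by
    simpa using H.integrable_cauchyKernel hzh 1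
  rw [Aplus, cauchyTransform, mul_smul_comm, lineIntegral, lineIntegral, integral_smul,
    integral_smul, mul_smul_comm,
    ← integral_const_mul_of_integrable (H.integrable_kernelA hp H.pos.ne')]
  congr 2
  have hpt : ∀ t : ℝ, resolventOp S z * kernelA S (h + t * I) =
      (1 / (((h : ℂ) + t * I) ^ 2 * ((h : ℂ) + t * I - z))) • resolventOp S (h + t * I) -
      (1 / (((h : ℂ) + t * I) ^ 2 * ((h : ℂ) + t * I - z))) • resolventOp S z := by
    intro t
    have hw : (h : ℂ) + t * I ∈ resolventSet S := H.mem _ (by simpa using hp)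
    rw [← smul_sub, resolventOp_sub hw hz, smul_smul, kernelA, mul_smul_comm,
      (resolventOp_commute hz hw).eq]
    congr 1
    have := line_sub_ne_zero hzh t
    field_simp
  simp only [hpt]
  rw [integral_sub hi1 (hi0.smul_const _), integral_smul_const, hzero, zero_smul, sub_zero]

theorem Aplus_apply_mem_Gplus (H : HasBoundedStrip S h M) (x : X) : Aplus S h x ∈ Gplus S := by
  obtain ⟨K, hK0, hK⟩ := H.exists_norm_cauchyTransform_le
  refine mem_Gplus_of_extension H.pos (ψ := fun z => cauchyTransform S h z x) ?_ ?_
    ⟨K * ‖x‖, fun z hz => ?_⟩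
  · intro z hz
    exact ((H.differentiableAt_cauchyTransform hz).clm_apply
      (differentiableAt_const x)).differentiableWithinAt
  · intro z hz hzh
    exact DFunLike.congr_fun (H.resolventOp_mul_Aplus hz hzh).symm x
  · exact ContinuousLinearMap.le_of_opNorm_le _ (hK z hz) x

/-- The bounded extension `φ` makes `z⁻² φ(z)` holomorphic and `O(|z|⁻²)` to the left of `Re z =
-h`, so the contour can be pushed to infinity there. -/
theorem Aminus_apply_eq_zero (H : HasBoundedStrip S h M) {x : X} (hx : x ∈ Gplus S) :
    Aminus S h x = 0 := by
  obtain ⟨φ, hφ, hφe, C, hC⟩ := hx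
  have hm : |-h| ≤ h := by rw [abs_neg, abs_of_pos H.pos]
  have hi := H.integrable_kernelA hm (neg_ne_zero.2 H.pos.ne')
  -- The reflection `z ↦ -z` moves the problem to the right half-plane, where
  -- `integral_vertical_eq_zero` applies.
  have hF : ∫ t : ℝ, (1 / ((h : ℂ) + t * I) ^ 2) • φ (-(h + t * I)) = 0 := by
    have hre : ∀ z : ℂ, h ≤ z.re → (-z).re ≤ 0 := fun z hz => by
      rw [neg_re]; linarith [H.pos]
    refine integral_vertical_eq_zero (F := fun z : ℂ => (1 / z ^ 2) • φ (-z)) (C := C) H.pos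
      (fun z hz => ?_) fun z hz => ?_
    · have hz0 : z ≠ 0 := by
        rintro rfl
        exact absurd hz (by simpa using H.pos)
      refine DifferentiableAt.smul ?_ ?_
      · exact (differentiableAt_const _).div (by fun_prop) (pow_ne_zero 2 hz0)
      · exact DifferentiableAt.comp (g := φ) z
          (hφ (-z) (Or.inl (hre z hz))).differentiableAt (by fun_prop)
    · rw [norm_smul, norm_div, norm_one, norm_pow, one_div, mul_comm]
      exact mul_le_mul_of_nonneg_right (hC _ (hre z hz)) (by positivity)
  have hline : lineIntegral (fun z => kernelA S z x) (-h) = 0 := by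
    rw [← lineIntegral_comp_neg, lineIntegral, integral_smul]
    refine smul_eq_zero_of_right _ (Eq.trans (integral_congr_ae ?_) hF)
    refine Eventually.of_forall fun t => ?_
    have hmem : -((h : ℂ) + t * I) ∈ resolventSet S :=
      H.mem _ (by simpa using (abs_of_pos H.pos).le)
    change (1 / (-((h : ℂ) + t * I)) ^ 2) • resolventOp S (-((h : ℂ) + t * I)) x = _
    rw [neg_sq, ← hφe _ hmem]
  change (-1 / (2 * (Real.pi : ℂ) * I)) • lineIntegral (kernelA S) (-h) x = 0
  rw [lineIntegral_apply hi, hline, smul_zero]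

theorem differentiableAt_extendedResolvent (H : HasBoundedStrip S h M) {z : ℂ} (hz : z.re < h) :
    DifferentiableAt ℂ (extendedResolvent S h) z := by
  have := H.differentiableAt_cauchyTransform hz
  unfold extendedResolvent
  fun_prop

/-- On `ker A₋` one has `A₊ x = R(0)² x`, so the remainder `z² R(z) R(0)² x` of the expansion equals
`z²` times the Cauchy transform of `x`. -/
theorem extendedResolvent_apply (H : HasBoundedStrip S h M) {x : X} (hx : Aminus S h x = 0)
    {z : ℂ} (hz : z ∈ resolventSet S) (hzh : z.re < h) :
    extendedResolvent S h z x = resolventOp S z x := by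
  have hA : Aplus S h x = (resolventOp S 0 * resolventOp S 0) x := by
    rw [← H.Aplus_add_Aminus]
    change _ = Aplus S h x + Aminus S h x
    rw [hx, add_zero]
  rw [H.resolventOp_eq_expansion hz, extendedResolvent, ← H.resolventOp_mul_Aplus hz hzh]
  change z ^ 2 • resolventOp S z (Aplus S h x) + resolventOp S 0 x +
      z • (resolventOp S 0 * resolventOp S 0) x = resolventOp S 0 x +
      z • (resolventOp S 0 * resolventOp S 0) x +
      z ^ 2 • resolventOp S z ((resolventOp S 0 * resolventOp S 0) x)
  rw [hA]
  abel

/-- On the imaginary axis the extension is the resolvent itself, bounded by `M`. The Cauchy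
transform is bounded for `Re z ≤ 0`, so growth is at most quadratic and Phragmén–Lindelöf carries
the same constant inside. -/
theorem norm_extendedResolvent_apply_le (H : HasBoundedStrip S h M) {x : X}
    (hx : Aminus S h x = 0) {z : ℂ} (hz : z.re ≤ 0) :
    ‖extendedResolvent S h z x‖ ≤ M * ‖x‖ := by
  obtain ⟨K, hK0, hK⟩ := H.exists_norm_cauchyTransform_le
  have hcl : closure {z : ℂ | 0 < z.re} = {z : ℂ | 0 ≤ z.re} := closure_setOfPred_lt_re 0
  have key := norm_le_of_quadratic_growth (f := fun w => extendedResolvent S h (-w) x)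
    (C := M * ‖x‖) (K := (K + ‖resolventOp S 0‖ + ‖resolventOp S 0 * resolventOp S 0‖) * ‖x‖)
    ?_ ?_ ?_ (z := -z) (by simpa using hz)
  · simpa using key
  · refine DifferentiableOn.diffContOnCl fun w hw => ?_
    rw [hcl] at hw
    have hw' : (-w).re < h := by
      rw [neg_re]
      exact lt_of_le_of_lt (neg_nonpos.2 hw) H.pos
    exact (DifferentiableAt.clm_apply (DifferentiableAt.comp (g := extendedResolvent S h) w
      (H.differentiableAt_extendedResolvent hw') (by fun_prop))
      (differentiableAt_const x)).differentiableWithinAt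
  · intro w hw
    have hKw := hK (-w) (by simpa using hw)
    rw [mul_right_comm]
    refine ContinuousLinearMap.le_of_opNorm_le _ ?_ x
    rw [extendedResolvent]
    have h1 : ‖w‖ ^ 2 ≤ (1 + ‖w‖) ^ 2 := by nlinarith [norm_nonneg w]
    have h2 : ‖w‖ ≤ (1 + ‖w‖) ^ 2 := by nlinarith [norm_nonneg w]
    have h3 : 1 ≤ (1 + ‖w‖) ^ 2 := by nlinarith [norm_nonneg w]
    refine (norm_add_le _ _).trans (le_trans (add_le_add_left (norm_add_le _ _) _) ?_)
    rw [norm_smul, norm_smul, norm_pow, norm_neg, add_mul, add_mul]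
    refine add_le_add (add_le_add ?_ ?_) ?_
    · rw [mul_comm]
      exact mul_le_mul hKw h1 (by positivity) hK0
    · exact le_mul_of_one_le_right (norm_nonneg _) h3
    · rw [mul_comm]
      exact mul_le_mul_of_nonneg_left h2 (norm_nonneg _)
  · intro t
    have hre : (-(t * I : ℂ)).re = 0 := by simp
    rw [H.extendedResolvent_apply hx (H.mem _ (by rw [hre, abs_zero]; exact H.pos.le))
      (by rw [hre]; exact H.pos)]
    exact ContinuousLinearMap.le_of_opNorm_le _
      (H.norm_le _ (by rw [hre, abs_zero]; exact H.pos.le)) x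

theorem mem_Gplus_iff (H : HasBoundedStrip S h M) {x : X} :
    x ∈ Gplus S ↔ Aminus S h x = 0 := by
  refine ⟨H.Aminus_apply_eq_zero, fun hx => ?_⟩
  refine mem_Gplus_of_extension H.pos (ψ := fun z => extendedResolvent S h z x) ?_ ?_
    ⟨M * ‖x‖, fun z hz => H.norm_extendedResolvent_apply_le hx hz⟩
  · intro z hz
    exact ((H.differentiableAt_extendedResolvent hz).clm_apply
      (differentiableAt_const x)).differentiableWithinAt
  · intro z hz hzh
    exact H.extendedResolvent_apply hx hz hzh

theorem mem_Gminus_iff (H : HasBoundedStrip S h M) {x : X} :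
    x ∈ Gminus S ↔ Aplus S h x = 0 := by
  rw [← Gplus_neg, H.neg.mem_Gplus_iff, Aminus_neg]

theorem Aminus_apply_mem_Gminus (H : HasBoundedStrip S h M) (x : X) :
    Aminus S h x ∈ Gminus S := by
  rw [← Gplus_neg, ← Aplus_neg]
  exact H.neg.Aplus_apply_mem_Gplus x

end HasBoundedStrip

end Extension

/-! ### Projections determined by a pair of subspaces -/

section Projections

variable {X : Type*} [NormedAddCommGroup X] [NormedSpace ℂ X] {P Q : X →ₗ.[ℂ] X}
  {G G' : Submodule ℂ X}

theorem mem_domain_iff_exists_graph {x : X} : x ∈ P.domain ↔ ∃ y, (x, y) ∈ P.graph := by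
  simp only [mem_graph_iff_exists]
  exact ⟨fun hx => ⟨_, hx, rfl⟩, fun ⟨_, hx, _⟩ => hx⟩

theorem mem_range_iff_exists_graph {y : X} :
    y ∈ LinearMap.range P.toFun ↔ ∃ x, (x, y) ∈ P.graph := by
  simp only [mem_graph_iff_exists, LinearMap.mem_range, Subtype.exists]
  rfl

/-- `P` is the projection onto `G` along `G'`, in terms of its graph. -/
def IsProjectionAlong (P : X →ₗ.[ℂ] X) (G G' : Submodule ℂ X) : Prop :=
  ∀ x y : X, (x, y) ∈ P.graph ↔ y ∈ G ∧ x - y ∈ G'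

namespace IsProjectionAlong

theorem domain_eq (hP : IsProjectionAlong P G G') : P.domain = G ⊔ G' := by
  ext x
  rw [mem_domain_iff_exists_graph, Submodule.mem_sup]
  constructor
  · rintro ⟨y, hy⟩
    obtain ⟨h1, h2⟩ := (hP x y).1 hy
    exact ⟨y, h1, x - y, h2, add_sub_cancel _ _⟩
  · rintro ⟨y, hy, z, hz, rfl⟩
    exact ⟨y, (hP _ _).2 ⟨hy, by rwa [add_sub_cancel_left]⟩⟩

theorem range_eq (hP : IsProjectionAlong P G G') : LinearMap.range P.toFun = G := by
  ext y
  rw [mem_range_iff_exists_graph]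
  constructor
  · rintro ⟨x, hx⟩
    exact ((hP x y).1 hx).1
  · intro hy
    exact ⟨y, (hP y y).2 ⟨hy, by rw [sub_self]; exact G'.zero_mem⟩⟩

theorem isClosed (hP : IsProjectionAlong P G G') (hG : IsClosed (G : Set X))
    (hG' : IsClosed (G' : Set X)) : P.IsClosed := by
  have : (P.graph : Set (X × X)) = {p | p.2 ∈ (G : Set X)} ∩ {p | p.1 - p.2 ∈ (G' : Set X)} := by
    ext ⟨x, y⟩
    exact hP x y
  rw [LinearPMap.IsClosed, this]
  exact (hG.preimage continuous_snd).inter (hG'.preimage (continuous_fst.sub continuous_snd))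

theorem isProjection (hP : IsProjectionAlong P G G') (hd : Disjoint G G') : IsProjection P := by
  constructor
  · intro x
    rw [hP.domain_eq]
    exact Submodule.mem_sup_left ((hP x (P x)).1 (P.mem_graph x)).1
  · refine LinearPMap.eq_of_eq_graph ?_
    ext ⟨x, y⟩
    rw [mem_graph_prodOp]
    simp only [hP _ _]
    constructor
    · rintro ⟨u, ⟨hu, hxu⟩, hy, huy⟩
      have : u - y = 0 := Submodule.disjoint_def.1 hd _ (G.sub_mem hu hy) huy
      rw [sub_eq_zero] at this
      subst this
      exact ⟨hu, hxu⟩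
    · rintro ⟨hy, hxy⟩
      exact ⟨y, ⟨hy, hxy⟩, hy, by rw [sub_self]; exact G'.zero_mem⟩

theorem eq_idOp_sub (hP : IsProjectionAlong P G G') (hQ : IsProjectionAlong Q G' G) :
    Q = idOp X - P := by
  refine LinearPMap.eq_of_eq_graph ?_
  ext ⟨x, y⟩
  rw [mem_graph_idOp_sub, hP, hQ, sub_sub_cancel, and_comm]

theorem apply_add (hP : IsProjectionAlong P G G') {x y : X} (hx : x ∈ G) (hy : y ∈ G') :
    ∃ hd : x + y ∈ P.domain, P ⟨x + y, hd⟩ = x :=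
  mem_graph_iff_exists.1 ((hP _ _).2 ⟨hx, by rwa [add_sub_cancel_left]⟩)

end IsProjectionAlong

end Projections

/-! ### Parts of `S` in `G₊` and `G₋`, their spectra, and the projections -/

section Restriction

variable {X : Type*} [NormedAddCommGroup X] [NormedSpace ℂ X] {S : X →ₗ.[ℂ] X} {h M : ℝ}

/-- The bounded operator induced by `T` in a `T`-invariant subspace. -/
def restrictBounded (T : X →L[ℂ] X) (G : Submodule ℂ X) (hT : ∀ x ∈ G, T x ∈ G) : G →L[ℂ] G :=
  (T.comp G.subtypeL).codRestrict G fun x => hT x x.2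

theorem coe_restrictBounded (T : X →L[ℂ] X) (G : Submodule ℂ X) (hT : ∀ x ∈ G, T x ∈ G) (x : G) :
    (restrictBounded T G hT x : X) = T x := rfl

namespace HasBoundedStrip

/-- A version of `isResolventAt_iff_mul` local to `G`: `extendedResolvent` satisfies the two
equations on `Gplus S`, even where `z` lies in the spectrum of `S`. -/
theorem isResolventAt_restrictTo (H : HasBoundedStrip S h M) {G : Submodule ℂ X} {z : ℂ}
    {T : X →L[ℂ] X} (hT : ∀ x ∈ G, T x ∈ G)
    (h1 : ∀ x ∈ G, T x = resolventOp S 0 x + z • resolventOp S 0 (T x))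
    (h2 : ∀ x ∈ G, T x = resolventOp S 0 x + z • T (resolventOp S 0 x)) :
    IsResolventAt (restrictTo S G) z (restrictBounded T G hT) := by
  rw [isResolventAt_iff]
  intro x y
  rw [mem_graph_restrictTo, H.mem_graph_iff, Subtype.ext_iff, coe_restrictBounded]
  have hsub : ((y - z • x : G) : X) = (y : X) - z • (x : X) := rfl
  rw [hsub]
  constructor
  · intro hxy
    rw [← hxy, map_sub, map_smul, h2 y y.2, add_sub_cancel_right]
  · intro hxy
    have h3 := h1 ((y : X) - z • (x : X)) (y - z • x).2
    rw [hxy, map_sub, map_smul] at h3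
    rw [h3]
    module

theorem isResolventAt_restrictTo_resolventOp (H : HasBoundedStrip S h M) {G : Submodule ℂ X}
    {z : ℂ} (hz : z ∈ resolventSet S) (hG : ∀ x ∈ G, resolventOp S z x ∈ G) :
    IsResolventAt (restrictTo S G) z (restrictBounded (resolventOp S z) G hG) := by
  obtain ⟨h1, h2⟩ := H.isResolventAt_iff_mul.1 (isResolventAt_resolventOp hz)
  exact H.isResolventAt_restrictTo hG (fun x _ => DFunLike.congr_fun h2 x)
    fun x _ => DFunLike.congr_fun h1 x

theorem restrictTo_resolvent_left (H : HasBoundedStrip S h M) {G : Submodule ℂ X} {z : ℂ}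
    {T : G →L[ℂ] G} (hT : IsResolventAt (restrictTo S G) z T) (x : G) :
    (T x : X) = resolventOp S 0 (x : X) + z • resolventOp S 0 (T x : X) := by
  have h1 := H.mem_graph_iff.1 (mem_graph_restrictTo.1 (hT.mem_graph x))
  rw [Submodule.coe_add, Submodule.coe_smul, map_add, map_smul] at h1
  exact h1.symm

theorem restrictTo_resolvent_right (H : HasBoundedStrip S h M) {G : Submodule ℂ X} {z : ℂ}
    {T : G →L[ℂ] G} (hT : IsResolventAt (restrictTo S G) z T) {x y : G}
    (hy : (y : X) = resolventOp S 0 (x : X)) :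
    (T x : X) = resolventOp S 0 (x : X) + z • (T y : X) := by
  have h1 : (y, x) ∈ (restrictTo S G).graph :=
    mem_graph_restrictTo.2 (H.mem_graph_iff.2 hy.symm)
  have h2 := (isResolventAt_iff.1 hT y x).1 h1
  rw [map_sub, map_smul, sub_eq_iff_eq_add] at h2
  rw [h2, ← hy]
  rfl

/-- Used with `T = A₋`, which makes `ker A₋` invariant, and with `T = R(0)`, which turns one
resolvent equation into the other. -/
theorem commute_extendedResolvent (H : HasBoundedStrip S h M) {T : X →L[ℂ] X}
    (hT : ∀ w ∈ resolventSet S, Commute T (resolventOp S w)) (z : ℂ) :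
    Commute T (extendedResolvent S h z) := by
  have h0 := hT 0 H.zero_mem
  have hc : Commute T (cauchyTransform S h z) :=
    Commute.smul_right (commute_lineIntegral fun _ => Commute.smul_right
      (hT _ (H.mem _ (by simpa using (abs_of_pos H.pos).le))) _) _
  exact ((hc.smul_right _).add_right h0).add_right ((h0.mul_right h0).smul_right _)

theorem mem_graph_Pplus_iff (H : HasBoundedStrip S h M) {x y : X} :
    (x, y) ∈ (Pplus S h).graph ↔ resolventOp S 0 (resolventOp S 0 y) = Aplus S h x := by
  rw [Pplus, mem_graph_prodOp]
  simp only [mem_graph_toPMap_top, H.mem_graph_sqOp_iff]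
  constructor
  · rintro ⟨u, h1, h2⟩
    rw [h2, ← h1]
    rfl
  · intro h1
    exact ⟨_, rfl, h1⟩

/-- Commuting `R(0)²` past `A₊` gives `R(0)² A₊ S² x = A₊ R(0)² S² x = A₊ x`. -/
theorem Pplus_apply_eq (H : HasBoundedStrip S h M) (x : (sqOp S).domain) :
    ∃ hd : (x : X) ∈ (Pplus S h).domain, Pplus S h ⟨x, hd⟩ = Aplus S h (sqOp S x) := by
  rw [← mem_graph_iff_exists, H.mem_graph_Pplus_iff]
  have hx := H.mem_graph_sqOp_iff.1 ((sqOp S).mem_graph x)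
  have hc : ∀ x, resolventOp S 0 (Aplus S h x) = Aplus S h (resolventOp S 0 x) :=
    fun x => DFunLike.congr_fun (H.resolventOp_commute_Aplus H.zero_mem).eq x
  rw [hc, hc, hx]

theorem Pminus_apply_eq (H : HasBoundedStrip S h M) (x : (sqOp S).domain) :
    ∃ hd : (x : X) ∈ (Pminus S h).domain, Pminus S h ⟨x, hd⟩ = Aminus S h (sqOp S x) := by
  have key : ∀ x y : X, (x, y) ∈ (sqOp S).graph → (x, Aminus S h y) ∈ (Pminus S h).graph := by
    intro x y hxy
    rw [← sqOp_neg] at hxy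
    obtain ⟨hx, rfl⟩ := mem_graph_iff_exists.1 hxy
    rw [← Pplus_neg, ← Aplus_neg]
    exact mem_graph_iff_exists.2 (H.neg.Pplus_apply_eq ⟨x, hx⟩)
  exact mem_graph_iff_exists.1 (key _ _ ((sqOp S).mem_graph x))

variable [CompleteSpace X]

/-- Both sides are holomorphic in the half-plane `Re z < h` and agree near `0`, where the extension
is the true resolvent. -/
theorem extendedResolvent_equation (H : HasBoundedStrip S h M) {x : X} (hx : x ∈ Gplus S) {z : ℂ}
    (hz : z.re < h) : extendedResolvent S h z x =
      resolventOp S 0 x + z • resolventOp S 0 (extendedResolvent S h z x) := by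
  have hx' := H.mem_Gplus_iff.1 hx
  have hd : DifferentiableOn ℂ (fun z => extendedResolvent S h z x) {z | z.re < h} := fun w hw =>
    ((H.differentiableAt_extendedResolvent hw).clm_apply
      (differentiableAt_const x)).differentiableWithinAt
  have hd' : DifferentiableOn ℂ
      (fun z => resolventOp S 0 x + z • resolventOp S 0 (extendedResolvent S h z x))
      {z | z.re < h} := by
    refine (differentiableOn_const _).add (differentiableOn_id.smul ?_)
    exact (resolventOp S 0).differentiable.comp_differentiableOn hd
  refine (hd.analyticOnNhd (isOpen_re_lt h)).eqOn_of_preconnected_of_eventuallyEq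
    (hd'.analyticOnNhd (isOpen_re_lt h)) (convex_halfSpace_re_lt h).isPreconnected
    (z₀ := 0) (by simpa using H.pos) ?_ hz
  have hopen : ∀ᶠ w : ℂ in 𝓝 0, |w.re| < h := by
    refine (isOpen_lt (by fun_prop) continuous_const).mem_nhds ?_
    simpa using H.pos
  filter_upwards [hopen] with w hw
  have hwρ := H.mem w hw.le
  rw [H.extendedResolvent_apply hx' hwρ ((le_abs_self _).trans_lt hw)]
  exact DFunLike.congr_fun (H.isResolventAt_iff_mul.1 (isResolventAt_resolventOp hwρ)).2 x

theorem isClosed_Gplus (H : HasBoundedStrip S h M) : IsClosed (Gplus S : Set X) := by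
  have : (Gplus S : Set X) = Aminus S h ⁻¹' {0} := by
    ext x
    exact H.mem_Gplus_iff
  rw [this]
  exact isClosed_singleton.preimage (Aminus S h).continuous

theorem resolventOp_mem_Gplus (H : HasBoundedStrip S h M) {z : ℂ} (hz : z ∈ resolventSet S)
    {x : X} (hx : x ∈ Gplus S) : resolventOp S z x ∈ Gplus S := by
  rw [H.mem_Gplus_iff] at hx ⊢
  have h1 := DFunLike.congr_fun (H.resolventOp_commute_Aminus hz).eq x
  change resolventOp S z (Aminus S h x) = Aminus S h (resolventOp S z x) at h1
  rw [← h1, hx, map_zero]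

theorem resolventOp_mem_Gminus (H : HasBoundedStrip S h M) {z : ℂ} (hz : z ∈ resolventSet S)
    {x : X} (hx : x ∈ Gminus S) : resolventOp S z x ∈ Gminus S := by
  rw [← Gplus_neg] at hx ⊢
  have := H.neg.resolventOp_mem_Gplus (neg_mem_resolventSet_neg.2 hz) hx
  rw [resolventOp_neg, neg_neg] at this
  simpa using neg_mem this

/-- `R(0)` is injective and commutes with `A₋`, so `A₋ R(0) y = 0` forces `A₋ y = 0`. Read with `x =
R(0) S x`, this is the `S`-invariance of `Gplus S`. -/
theorem mem_Gplus_of_resolventOp_mem (H : HasBoundedStrip S h M) {y : X}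
    (hy : resolventOp S 0 y ∈ Gplus S) : y ∈ Gplus S := by
  rw [H.mem_Gplus_iff] at hy ⊢
  have h1 := DFunLike.congr_fun (H.resolventOp_commute_Aminus H.zero_mem).eq y
  change resolventOp S 0 (Aminus S h y) = Aminus S h (resolventOp S 0 y) at h1
  rw [hy] at h1
  exact H.resolvent_zero_injective (by rw [h1, map_zero])

theorem isInvariantUnder_Gplus (H : HasBoundedStrip S h M) : IsInvariantUnder S (Gplus S) := by
  intro x hx
  refine H.mem_Gplus_of_resolventOp_mem ?_
  rwa [H.mem_graph_iff.1 (S.mem_graph x)]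

theorem isInvariantUnder_Gminus (H : HasBoundedStrip S h M) : IsInvariantUnder S (Gminus S) := by
  intro x hx
  rw [← Gplus_neg] at hx ⊢
  simpa using neg_mem (H.neg.isInvariantUnder_Gplus x hx)

theorem mem_resolventSet_restrictTo_Gplus (H : HasBoundedStrip S h M) {z : ℂ} (hz : z.re ≤ 0) :
    z ∈ resolventSet (restrictTo S (Gplus S)) ∧
      ‖resolventOp (restrictTo S (Gplus S)) z‖ ≤ M := by
  have hzh : z.re < h := hz.trans_lt H.pos
  have hmem : ∀ x ∈ Gplus S, extendedResolvent S h z x ∈ Gplus S := by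
    intro x hx
    rw [H.mem_Gplus_iff] at hx ⊢
    have h1 := DFunLike.congr_fun (H.commute_extendedResolvent
      (fun w hw => (H.resolventOp_commute_Aminus hw).symm) z).eq x
    change Aminus S h (extendedResolvent S h z x) = extendedResolvent S h z (Aminus S h x) at h1
    rw [h1, hx, map_zero]
  have hcomm : ∀ x, resolventOp S 0 (extendedResolvent S h z x) =
      extendedResolvent S h z (resolventOp S 0 x) := fun x => DFunLike.congr_fun
    (H.commute_extendedResolvent (fun w hw => resolventOp_commute H.zero_mem hw) z).eq x
  have hres := H.isResolventAt_restrictTo hmem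
    (fun x hx => H.extendedResolvent_equation hx hzh)
    (fun x hx => by rw [← hcomm]; exact H.extendedResolvent_equation hx hzh)
  refine ⟨⟨_, hres⟩, ?_⟩
  rw [hres.resolventOp_eq]
  exact ContinuousLinearMap.opNorm_le_bound _ H.nonneg fun x =>
    H.norm_extendedResolvent_apply_le (H.mem_Gplus_iff.1 x.2) hz

theorem mem_resolventSet_restrictTo_Gminus (H : HasBoundedStrip S h M) {z : ℂ} (hz : 0 ≤ z.re) :
    z ∈ resolventSet (restrictTo S (Gminus S)) ∧
      ‖resolventOp (restrictTo S (Gminus S)) z‖ ≤ M := by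
  have key := H.neg.mem_resolventSet_restrictTo_Gplus (z := -z) (by simpa using hz)
  rw [Gplus_neg, restrictTo_neg, neg_mem_resolventSet_neg, resolventOp_neg, neg_neg,
    norm_neg] at key
  exact key

theorem mem_resolventSet_of_restrictTo (H : HasBoundedStrip S h M) {z : ℂ}
    (hp : z ∈ resolventSet (restrictTo S (Gplus S)))
    (hm : z ∈ resolventSet (restrictTo S (Gminus S))) : z ∈ resolventSet S := by
  obtain ⟨Tp, hTp⟩ := hp
  obtain ⟨Tm, hTm⟩ := hm
  let Ap : X →L[ℂ] Gplus S := (Aplus S h).codRestrict _ H.Aplus_apply_mem_Gplus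
  let Am : X →L[ℂ] Gminus S := (Aminus S h).codRestrict _ H.Aminus_apply_mem_Gminus
  -- `W` is the candidate for `R(z) R(0)²`: since `A₊` and `A₋` sum to `R(0)²`, each summand is
  -- treated by the resolvent of its own part.
  let W : X →L[ℂ] X :=
    (Gplus S).subtypeL.comp (Tp.comp Ap) + (Gminus S).subtypeL.comp (Tm.comp Am)
  set Q := resolventOp S 0 with hQ
  have hW : ∀ x, W x = (Tp (Ap x) : X) + (Tm (Am x) : X) := fun _ => rfl
  have hsum : ∀ x, Aplus S h x + Aminus S h x = Q (Q x) :=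
    fun x => DFunLike.congr_fun H.Aplus_add_Aminus x
  have hcp : ∀ x, Q (Aplus S h x) = Aplus S h (Q x) :=
    fun x => DFunLike.congr_fun (H.resolventOp_commute_Aplus H.zero_mem).eq x
  have hcm : ∀ x, Q (Aminus S h x) = Aminus S h (Q x) :=
    fun x => DFunLike.congr_fun (H.resolventOp_commute_Aminus H.zero_mem).eq x
  have hW1 : ∀ x, W x = Q (Q (Q x)) + z • Q (W x) := by
    intro x
    have h1 := H.restrictTo_resolvent_left hTp (Ap x)
    have h2 := H.restrictTo_resolvent_left hTm (Am x)
    change (Tp (Ap x) : X) = Q (Aplus S h x) + z • Q (Tp (Ap x) : X) at h1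
    change (Tm (Am x) : X) = Q (Aminus S h x) + z • Q (Tm (Am x) : X) at h2
    rw [← hsum, ← hcp, ← hcm, hW, map_add]
    linear_combination (norm := module) h1 + h2
  have hW2 : ∀ x, W x = Q (Q (Q x)) + z • W (Q x) := by
    intro x
    have h1 := H.restrictTo_resolvent_right hTp (x := Ap x) (y := Ap (Q x)) (hcp x).symm
    have h2 := H.restrictTo_resolvent_right hTm (x := Am x) (y := Am (Q x)) (hcm x).symm
    change (Tp (Ap x) : X) = Q (Aplus S h x) + z • (Tp (Ap (Q x)) : X) at h1
    change (Tm (Am x) : X) = Q (Aminus S h x) + z • (Tm (Am (Q x)) : X) at h2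
    rw [← hsum, ← hcp, ← hcm, hW, hW]
    linear_combination (norm := module) h1 + h2
  -- The witness is the second-order expansion of `R(z)` with `W` in place of `R(z) R(0)²`.
  refine ⟨z ^ 2 • W + z • (Q * Q) + Q, H.isResolventAt_iff_mul.2 ⟨?_, ?_⟩⟩
  · ext x
    change z ^ 2 • W x + z • Q (Q x) + Q x =
      Q x + z • (z ^ 2 • W (Q x) + z • Q (Q (Q x)) + Q (Q x))
    linear_combination (norm := module) (z ^ 2) • hW2 x
  · ext x
    change z ^ 2 • W x + z • Q (Q x) + Q x =
      Q x + z • Q (z ^ 2 • W x + z • Q (Q x) + Q x)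
    simp only [map_add, map_smul]
    linear_combination (norm := module) (z ^ 2) • hW1 x

/-- On the intersection both `A₋` and `A₊` vanish, hence so does their sum, the injective operator
`R(0)²`. -/
theorem disjoint_Gplus_Gminus (H : HasBoundedStrip S h M) : Disjoint (Gplus S) (Gminus S) := by
  rw [Submodule.disjoint_def]
  intro x hp hm
  have h1 := DFunLike.congr_fun H.Aplus_add_Aminus x
  change Aplus S h x + Aminus S h x = resolventOp S 0 (resolventOp S 0 x) at h1
  rw [H.mem_Gplus_iff.1 hp, H.mem_Gminus_iff.1 hm, add_zero] at h1
  refine H.resolvent_zero_injective (H.resolvent_zero_injective ?_)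
  rw [← h1, map_zero, map_zero]

theorem isProjectionAlong_Pplus (H : HasBoundedStrip S h M) :
    IsProjectionAlong (Pplus S h) (Gplus S) (Gminus S) := by
  intro x y
  have hsum := DFunLike.congr_fun H.Aplus_add_Aminus y
  change Aplus S h y + Aminus S h y = resolventOp S 0 (resolventOp S 0 y) at hsum
  rw [H.mem_graph_Pplus_iff, H.mem_Gminus_iff, map_sub, sub_eq_zero]
  constructor
  · intro hxy
    -- `R(0)² y = A₊ x` lies in `G₊`, and membership descends through each factor `R(0)`.
    have hy : y ∈ Gplus S := by
      refine H.mem_Gplus_of_resolventOp_mem (H.mem_Gplus_of_resolventOp_mem ?_)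
      rw [hxy]
      exact H.Aplus_apply_mem_Gplus x
    refine ⟨hy, ?_⟩
    rw [← hxy, ← hsum, H.mem_Gplus_iff.1 hy, add_zero]
  · rintro ⟨hy, hxy⟩
    rw [← hsum, H.mem_Gplus_iff.1 hy, add_zero, hxy]

theorem isProjectionAlong_Pminus (H : HasBoundedStrip S h M) :
    IsProjectionAlong (Pminus S h) (Gminus S) (Gplus S) := by
  have key := H.neg.isProjectionAlong_Pplus
  rwa [Pplus_neg, Gplus_neg, Gminus_neg] at key

theorem spectrumOf_restrictTo_Gplus (H : HasBoundedStrip S h M) :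
    spectrumOf (restrictTo S (Gplus S)) = spectrumOf S ∩ {z : ℂ | 0 < z.re} := by
  ext z
  simp only [spectrumOf, mem_inter_iff, mem_compl_iff, mem_ofPred_eq]
  constructor
  · refine fun hz => ⟨fun hz' => hz ⟨_, H.isResolventAt_restrictTo_resolventOp hz'
      fun x => H.resolventOp_mem_Gplus hz'⟩, ?_⟩
    by_contra! hre
    exact hz (H.mem_resolventSet_restrictTo_Gplus hre).1
  · rintro ⟨hz, hre⟩ hz'
    -- For `Re z > 0` the part in `G₋` always has a resolvent at `z`, so only the part in `G₊` can
    -- put `z` in the spectrum of `S`.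
    exact hz (H.mem_resolventSet_of_restrictTo hz' (H.mem_resolventSet_restrictTo_Gminus hre.le).1)

theorem spectrumOf_restrictTo_Gminus (H : HasBoundedStrip S h M) :
    spectrumOf (restrictTo S (Gminus S)) = spectrumOf S ∩ {z : ℂ | z.re < 0} := by
  ext z
  simp only [spectrumOf, mem_inter_iff, mem_compl_iff, mem_ofPred_eq]
  constructor
  · refine fun hz => ⟨fun hz' => hz ⟨_, H.isResolventAt_restrictTo_resolventOp hz'
      fun x => H.resolventOp_mem_Gminus hz'⟩, ?_⟩
    by_contra! hre
    exact hz (H.mem_resolventSet_restrictTo_Gminus hre).1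
  · rintro ⟨hz, hre⟩ hz'
    exact hz (H.mem_resolventSet_of_restrictTo (H.mem_resolventSet_restrictTo_Gplus hre.le).1 hz')

theorem spectrumOf_eq_union (H : HasBoundedStrip S h M) :
    spectrumOf S =
      spectrumOf (restrictTo S (Gplus S)) ∪ spectrumOf (restrictTo S (Gminus S)) := by
  rw [H.spectrumOf_restrictTo_Gplus, H.spectrumOf_restrictTo_Gminus, ← inter_union_distrib_left,
    eq_comm, inter_eq_left]
  intro z hz
  rcases lt_trichotomy z.re 0 with hre | hre | hre
  · exact Or.inr hre
  · exact absurd (H.mem z (by rw [hre, abs_zero]; exact H.pos.le)) hz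
  · exact Or.inl hre

end HasBoundedStrip

end Restriction

end SpectralSplitting

end

/-! ### The main theorem -/

open SpectralSplitting in
theorem theorem4p1 {X : Type*} [NormedAddCommGroup X] [NormedSpace ℂ X] [CompleteSpace X]
    (S : X →ₗ.[ℂ] X) (h : ℝ) (hh : 0 < h)
    (hstrip : {z : ℂ | |z.re| ≤ h} ⊆ resolventSet S)
    (M : ℝ) (hM : IsLUB ((fun z : ℂ => ‖resolventOp S z‖) '' {z : ℂ | |z.re| ≤ h}) M) :
    -- (i) the subspaces
    (IsClosed (Gplus S : Set X) ∧ IsClosed (Gminus S : Set X) ∧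
      IsInvariantUnder S (Gplus S) ∧ IsInvariantUnder S (Gminus S) ∧
      (∀ z ∈ resolventSet S, ∀ x ∈ Gplus S, resolventOp S z x ∈ Gplus S) ∧
      (∀ z ∈ resolventSet S, ∀ x ∈ Gminus S, resolventOp S z x ∈ Gminus S) ∧
      spectrumOf S =
        spectrumOf (restrictTo S (Gplus S)) ∪ spectrumOf (restrictTo S (Gminus S)) ∧
      spectrumOf (restrictTo S (Gplus S)) = spectrumOf S ∩ {z : ℂ | 0 < z.re} ∧
      spectrumOf (restrictTo S (Gminus S)) = spectrumOf S ∩ {z : ℂ | z.re < 0} ∧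
      (∀ z : ℂ, z.re ≤ 0 → z ∈ resolventSet (restrictTo S (Gplus S)) ∧
        ‖resolventOp (restrictTo S (Gplus S)) z‖ ≤ M) ∧
      (∀ z : ℂ, 0 ≤ z.re → z ∈ resolventSet (restrictTo S (Gminus S)) ∧
        ‖resolventOp (restrictTo S (Gminus S)) z‖ ≤ M)) ∧
    -- (ii) the integrals defining `A₊`, `A₋` converge, and the projections
    (MeasureTheory.Integrable (fun t : ℝ => kernelA S (h + t * Complex.I)) ∧
      MeasureTheory.Integrable (fun t : ℝ => kernelA S (-h + t * Complex.I)) ∧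
      (Pplus S h).IsClosed ∧ (Pminus S h).IsClosed ∧
      AreComplementaryProjections (Pplus S h) (Pminus S h) ∧
      Disjoint (Gplus S) (Gminus S) ∧
      (Pplus S h).domain = Gplus S ⊔ Gminus S ∧
      (Pminus S h).domain = Gplus S ⊔ Gminus S ∧
      LinearMap.range (Pplus S h).toFun = Gplus S ∧
      LinearMap.range (Pminus S h).toFun = Gminus S ∧
      LinearMap.ker (Aminus S h : X →ₗ[ℂ] X) = Gplus S ∧
      LinearMap.ker (Aplus S h : X →ₗ[ℂ] X) = Gminus S ∧
      (∀ x ∈ Gplus S, ∀ y ∈ Gminus S,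
        (∃ hd : x + y ∈ (Pplus S h).domain, Pplus S h ⟨x + y, hd⟩ = x) ∧
        (∃ hd : x + y ∈ (Pminus S h).domain, Pminus S h ⟨x + y, hd⟩ = y))) ∧
    -- (iii) the integral representation on `D(S²)`
    (∀ x : (sqOp S).domain,
      (MeasureTheory.Integrable (fun t : ℝ =>
          (1 / ((h : ℂ) + t * Complex.I) ^ 2) • resolventOp S (h + t * Complex.I) (sqOp S x)) ∧
        ∃ hd : (x : X) ∈ (Pplus S h).domain, Pplus S h ⟨x, hd⟩ =
          (1 / (2 * (Real.pi : ℂ) * Complex.I)) •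
            lineIntegral (fun z : ℂ => (1 / z ^ 2) • resolventOp S z (sqOp S x)) h) ∧
      (MeasureTheory.Integrable (fun t : ℝ =>
          (1 / (-(h : ℂ) + t * Complex.I) ^ 2) •
            resolventOp S (-h + t * Complex.I) (sqOp S x)) ∧
        ∃ hd : (x : X) ∈ (Pminus S h).domain, Pminus S h ⟨x, hd⟩ =
          (-1 / (2 * (Real.pi : ℂ) * Complex.I)) •
            lineIntegral (fun z : ℂ => (1 / z ^ 2) • resolventOp S z (sqOp S x)) (-h))) := by
  have H : HasBoundedStrip S h M :=
    ⟨hh, fun z hz => hstrip hz, fun z hz => hM.1 ⟨z, hz, rfl⟩⟩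
  have hP := H.isProjectionAlong_Pplus
  have hQ := H.isProjectionAlong_Pminus
  have hd := H.disjoint_Gplus_Gminus
  have hclp := H.isClosed_Gplus
  have hclm : IsClosed (Gminus S : Set X) := Gplus_neg S ▸ H.neg.isClosed_Gplus
  have hp : |h| ≤ h := (abs_of_pos hh).le
  have hip := H.integrable_kernelA hp hh.ne'
  have him := H.integrable_kernelA (by rwa [abs_neg]) (neg_ne_zero.2 hh.ne')
  have him' : MeasureTheory.Integrable fun t : ℝ => kernelA S (-h + t * Complex.I) := by
    simpa using him
  refine ⟨⟨hclp, hclm, H.isInvariantUnder_Gplus, H.isInvariantUnder_Gminus,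
    fun z hz x hx => H.resolventOp_mem_Gplus hz hx, fun z hz x hx => H.resolventOp_mem_Gminus hz hx,
    H.spectrumOf_eq_union, H.spectrumOf_restrictTo_Gplus, H.spectrumOf_restrictTo_Gminus,
    fun z hz => H.mem_resolventSet_restrictTo_Gplus hz,
    fun z hz => H.mem_resolventSet_restrictTo_Gminus hz⟩,
    ⟨hip, him', hP.isClosed hclp hclm, hQ.isClosed hclm hclp,
    ⟨hP.isProjection hd, hQ.isProjection hd.symm, hP.eq_idOp_sub hQ⟩, hd, hP.domain_eq,
    by rw [hQ.domain_eq, sup_comm], hP.range_eq, hQ.range_eq,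
    Submodule.ext fun x => H.mem_Gplus_iff.symm, Submodule.ext fun x => H.mem_Gminus_iff.symm,
    fun x hx y hy => ⟨hP.apply_add hx hy, ?_⟩⟩, fun x => ⟨⟨?_, ?_⟩, ?_, ?_⟩⟩
  · simpa only [add_comm] using hQ.apply_add hy hx
  · exact (ContinuousLinearMap.apply ℂ X (sqOp S x)).integrable_comp hip
  · obtain ⟨hx, h1⟩ := H.Pplus_apply_eq x
    refine ⟨hx, h1.trans ?_⟩
    exact congrArg _ (lineIntegral_apply hip (sqOp S x))
  · exact (ContinuousLinearMap.apply ℂ X (sqOp S x)).integrable_comp him'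
  · obtain ⟨hx, h1⟩ := H.Pminus_apply_eq x
    refine ⟨hx, h1.trans ?_⟩
    exact congrArg _ (lineIntegral_apply him (sqOp S x))
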